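/- Let $N\ge 3$ and let $\mathcal A_N$ be the complex Lie algebra generated by letters $e_i$, $i\in\mathbb Z/N\mathbb Z$, subject to the generalized Dolan–Grady relations $[e_i,[e_i,e_j]]=e_j$ if $j=i\pm1$, and $[e_i,e_j]=0$ if $j\neq i\pm 1$. In any Lie algebra containing elements $e_i$ ($i\in\mathbb Z/N\mathbb Z$) define the strings $S_i(r)=[e_i,[e_{i+1},[\dots,[e_{i+r-2},e_{i+r-1}]\dots]]]$ for $r\ge1$ (so $S_i(1)=e_i$). For constants $k_i\in\mathbb C$, $i\in\mathbb Z/N\mathbb Z$, put $$I_0=H=\sum_{i} k_i e_i,\qquad I_m=\sum_{i} k_i\bigl(S_i(Nm+1)+2S_{i+1}(Nm-1)\bigr)\quad(m\ge1).$$ Then: 1. $[I_m,I_n]=0$ in $\mathcal A_N$ for all $m,n\ge0$. 2. For every complex vector space $V$ and all linear operators $e_i$ ($i\in\mathbb Z/N\mathbb Z$) on $V$ satisfying the generalized Dolan–Grady relations (with the commutator as bracket), the operators $I_m$ built from them by the same formulas satisfy $[I_m,I_n]=0$ for all $m,n\ge0$. 3. If the constants $k_i$ are not all zero, then the elements $I_m$,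 $m\ge0$, of $\mathcal A_N$ are linearly independent over $\mathbb C$. -/

import Mathlib

namespace SlOnsager

/-- Adjacency in the Dynkin graph of type `A_{N-1}^{(1)}` (a cycle with `N` vertices, `N ≥ 3`),
whose vertices are labelled cyclically by `ZMod N`. -/
def Adjacent {N : ℕ} (i j : ZMod N) : Prop := j = i + 1 ∨ i = j + 1

/-- The generalized Dolan-Grady relations for a family `e` of elements of a Lie algebra. -/
structure DolanGrady {N : ℕ} {L : Type*} [LieRing L] (e : ZMod N → L) : Prop where
  adjacent : ∀ i j, Adjacent i j → ⁅e i, ⁅e i, e j⁆⁆ = e j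
  not_adjacent : ∀ i j, ¬ Adjacent i j → ⁅e i, e j⁆ = 0

/-- The letters, inside the free complex Lie algebra on them. -/
noncomputable def letter {N : ℕ} (i : ZMod N) : FreeLieAlgebra ℂ (ZMod N) :=
  FreeLieAlgebra.of ℂ i

/-- The differences of the two sides of the defining relations, in the free Lie algebra. -/
def relators (N : ℕ) : Set (FreeLieAlgebra ℂ (ZMod N)) :=
  {x | ∃ i j : ZMod N, Adjacent i j ∧ x = ⁅letter i, ⁅letter i, letter j⁆⁆ - letter j} ∪
  {x | ∃ i j : ZMod N, ¬ Adjacent i j ∧ x = ⁅letter i, letter j⁆}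

/-- The Lie ideal generated by the defining relations. -/
noncomputable def relationIdeal (N : ℕ) : LieIdeal ℂ (FreeLieAlgebra ℂ (ZMod N)) :=
  LieSubmodule.lieSpan ℂ (FreeLieAlgebra ℂ (ZMod N)) (relators N)

/-- The `sl(N)` Onsager algebra `A_N`: the complex Lie algebra generated by letters `e_i`
subject to the generalized Dolan-Grady relations. -/
abbrev OnsagerAlgebra (N : ℕ) : Type :=
  FreeLieAlgebra ℂ (ZMod N) ⧸ relationIdeal N

/-- The generators `e_i` of `A_N`. -/
noncomputable def gen {N : ℕ} (i : ZMod N) : OnsagerAlgebra N :=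
  LieSubmodule.Quotient.mk (letter i)

/-- The string `S_i(r) = [e_i, [e_{i+1}, [..., e_{i+r-1}]...]]` of length `r`;
the string of length `0` is zero. -/
def strand {N : ℕ} {L : Type*} [LieRing L] (e : ZMod N → L) : ZMod N → ℕ → L
  | _, 0 => 0
  | i, 1 => e i
  | i, r + 2 => ⁅e i, strand e (i + 1) (r + 1)⁆

/-- The Hamiltonian `H = ∑ k_i e_i`. -/
noncomputable def hamiltonian {N : ℕ} [NeZero N] {L : Type*} [LieRing L] [LieAlgebra ℂ L]
    (e : ZMod N → L) (k : ZMod N → ℂ) : L :=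
  ∑ i, k i • e i

/-- `I_0 = H` and `I_m = ∑ k_i (S_i(Nm+1) + 2 S_{i+1}(Nm-1))` for `m ≥ 1`. -/
noncomputable def integral {N : ℕ} [NeZero N] {L : Type*} [LieRing L] [LieAlgebra ℂ L]
    (e : ZMod N → L) (k : ZMod N → ℂ) (m : ℕ) : L :=
  if m = 0 then hamiltonian e k
  else ∑ i, k i • (strand e i (N * m + 1) + (2 : ℂ) • strand e (i + 1) (N * m - 1))

end SlOnsager

-- The bracket of linear operators is their commutator.
attribute [local instance 100] LieRing.ofAssociativeRing

-- The bracket of linear operators is their commutator.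
attribute [local instance 100] LieRing.ofAssociativeRing

namespace SlOnsager

open scoped LaurentPolynomial Polynomial
open LaurentPolynomial (T)

/-! ### Consequences of the Jacobi identity for elements with `ad b` of square one. -/

section LieIdentities

variable {L : Type*} [LieRing L] [LieAlgebra ℂ L]

/-! The letters have a model by matrices over Laurent polynomials in T, with e_j acting as E_{j,j+1}
T + E_{j+1,j} T⁻¹ (`loopGen`). Strings can be computed there: with t = T^N and the scalar U = t +
(-1)^N t⁻¹, `integral_loopGen` gives I_m = p_m(U) H with p_m a polynomial of degree m. So the I_m
commute in the model, and they are independent when k ≠ 0 because U takes every complex value.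
Independence lifts to A_N along the homomorphism from A_N to the model.

Commutativity must travel the other way, through a linear map `realize` from matrices back to an
algebra generated by letters satisfying the relations. There `seg` builds candidates for X_{a,a+r},
or for X_{a,a+r} - X_{a+1,a+r+1} if N ∣ r, and `segRel` derives the action of the letters on them
from the Dolan-Grady relations alone, by induction on the length. For N ∣ r the single X_{a,a+r} is
recovered by discrete integration around the cycle (`hat`); the obstruction is the sum of `seg e b
r` over all b.

These sums are central (`lie_sum_seg_eq_zero`), so `realize` respects brackets with the subalgebra
generated by the `loopGen j` modulo the centre. That is enough to compute brackets of segments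
closing up the cycle (`lie_seg_eq_sum`), and antisymmetry then makes the sums vanish
(`sum_seg_eq_zero`). Hence `lie_realize` holds exactly, and `realize` carries each I_m of the model
to I_m. Operators are reached by the universal property of A_N. -/

theorem lie_lie_lie_eq (a b x : L) :
    ⁅a, ⁅a, ⁅b, x⁆⁆⁆ = ⁅⁅a, ⁅a, b⁆⁆, x⁆ + (2 : ℂ) • ⁅⁅a, b⁆, ⁅a, x⁆⁆ + ⁅b, ⁅a, ⁅a, x⁆⁆⁆ := by
  simp only [lie_lie, lie_sub]
  module

/-- The product of two elements on which `ad b` squares to the identity. -/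
theorem lie_lie_of_involutive {a b v : L} (ha : ⁅b, ⁅b, a⁆⁆ = a) (hv : ⁅b, ⁅b, v⁆⁆ = v) :
    ⁅b, ⁅b, ⁅a, v⁆⁆⁆ = (2 : ℂ) • ⁅b, ⁅a, ⁅b, v⁆⁆⁆ := by
  rw [lie_lie_lie_eq, ha, hv, leibniz_lie b a ⁅b, v⁆, hv]
  module

/-- Since `ad b` has eigenvalues ±1 on the components of `a` and `v`, it has eigenvalues 0, ±2 on
their bracket. -/
theorem lie_lie_lie_of_involutive {a b v : L} (ha : ⁅b, ⁅b, a⁆⁆ = a) (hv : ⁅b, ⁅b, v⁆⁆ = v) :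
    ⁅b, ⁅b, ⁅b, ⁅a, v⁆⁆⁆⁆ = (4 : ℂ) • ⁅b, ⁅a, v⁆⁆ := by
  rw [lie_lie_of_involutive ha hv, lie_smul, lie_lie_of_involutive ha (by rw [hv]), hv]
  module

theorem lie_lie_lie_eq_zero {a b z : L} (hb : ⁅b, ⁅b, a⁆⁆ = a) (haz : ⁅a, z⁆ = 0)
    (hbz : ⁅b, ⁅b, z⁆⁆ = z) : ⁅b, ⁅a, ⁅b, z⁆⁆⁆ = 0 := by
  have h := lie_lie_of_involutive hb hbz
  rw [haz, lie_zero, lie_zero] at h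
  simpa using h.symm

/-- Writing x for `⁅a, ⁅a, w'⁆⁆`, the Leibniz expansion of `⁅a, ⁅a, ⁅b, d⁆⁆⁆` reads x = 4x - 3w'. -/
theorem lie_lie_eq_self_of_cartan {a b d w w' : L} (hab : ⁅a, ⁅a, b⁆⁆ = b) (hb : ⁅b, d⁆ = w')
    (ha : ⁅a, d⁆ = (-2 : ℂ) • w) (haw : ⁅a, w⁆ = (-2 : ℂ) • d) (haw' : ⁅a, w'⁆ = -⁅b, w⁆) :
    ⁅a, ⁅a, w'⁆⁆ = w' := by
  have h := lie_lie_lie_eq a b d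
  have h1 : ⁅⁅a, b⁆, w⁆ = ⁅a, ⁅b, w⁆⁆ - ⁅b, ⁅a, w⁆⁆ := lie_lie a b w
  rw [hab, hb, ha, lie_smul, lie_smul, haw, lie_smul, lie_smul, h1, haw, lie_smul, hb] at h
  rw [haw', lie_neg] at h ⊢
  have h3 : (3 : ℂ) • (-⁅a, ⁅b, w⁆⁆) = (3 : ℂ) • w' := by
    linear_combination (norm := module) (-1 : ℂ) • h
  exact smul_right_injective L (by norm_num : (3 : ℂ) ≠ 0) h3

/-- Here `w` and `w'` play the part of `⁅a, d'⁆` and `⁅b, d⁆`, where `d = ⁅a, ⁅b, v⁆⁆` and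
`d' = -⁅b, ⁅a, v⁆⁆`. -/
theorem lie_eq_neg_lie_of_cartan {a b v d d' w w' : L} (hab : ⁅a, ⁅a, b⁆⁆ = b)
    (hba : ⁅b, ⁅b, a⁆⁆ = a) (hav : ⁅a, ⁅a, v⁆⁆ = v) (hbv : ⁅b, ⁅b, v⁆⁆ = v)
    (hd : ⁅a, ⁅b, v⁆⁆ = d) (hd' : -⁅b, ⁅a, v⁆⁆ = d') (had : ⁅a, d⁆ = (-2 : ℂ) • w)
    (hbd : ⁅b, d⁆ = w') (hbd' : ⁅b, d'⁆ = (-2 : ℂ) • w') :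
    ⁅b, w⁆ = -⁅a, w'⁆ := by
  -- The bracket of `⁅a, b⁆` with `d` is computed twice: directly by Jacobi, then through `d = ⁅a,
  -- ⁅b, v⁆⁆`, where `ad ⁅a, b⁆` rotates `a` to `-b` and `b` to `a`.
  have h1 : ⁅⁅a, b⁆, d⁆ = ⁅a, w'⁆ + (2 : ℂ) • ⁅b, w⁆ := by
    rw [lie_lie, hbd, had, lie_smul]; module
  have h2 : ⁅⁅a, b⁆, d⁆ = -⁅a, w'⁆ := by
    have hx : ⁅⁅a, b⁆, v⁆ = d + d' := by rw [lie_lie, hd, ← hd']; abel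
    have ha : ⁅⁅a, b⁆, a⁆ = -b := by rw [← lie_skew, hab]
    have hb : ⁅⁅a, b⁆, b⁆ = a := by rw [← lie_skew, ← lie_skew a b, lie_neg, neg_neg, hba]
    rw [← hd, leibniz_lie ⁅a, b⁆, leibniz_lie ⁅a, b⁆ b v, ha, hb, neg_lie, hbv, hx, lie_add, hav,
      lie_add, hbd, hbd', lie_add, lie_smul]
    module
  have h3 : (2 : ℂ) • ⁅b, w⁆ = (2 : ℂ) • (-⁅a, w'⁆) := by
    linear_combination (norm := module) h2 - h1
  exact smul_right_injective L (by norm_num : (2 : ℂ) ≠ 0) h3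

end LieIdentities

/-- Supplies `grind` with 1 ≠ 0 and 2 ≠ 0 modulo `N`, phrased through a variable `u`. -/
theorem exists_one_eq {N : ℕ} (hN : 3 ≤ N) : ∃ u : ZMod N, 1 = u ∧ u ≠ 0 ∧ u + u ≠ 0 := by
  refine ⟨1, rfl, ?_, ?_⟩
  · intro h
    have : ((1 : ℕ) : ZMod N) = 0 := by exact_mod_cast h
    rw [ZMod.natCast_eq_zero_iff] at this
    exact absurd (Nat.le_of_dvd one_pos this) (by omega)
  · intro h
    have : ((2 : ℕ) : ZMod N) = 0 := by push_cast; rw [← one_add_one_eq_two, h]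
    rw [ZMod.natCast_eq_zero_iff] at this
    exact absurd (Nat.le_of_dvd two_pos this) (by omega)

theorem eq_zero_or_exists {N n : ℕ} (hN : 3 ≤ N) (h : (n : ZMod N) = 0) : n = 0 ∨ ∃ p, n = p + 3 := by
  rw [ZMod.natCast_eq_zero_iff] at h
  rcases Nat.eq_zero_or_pos n with h0 | h0
  · exact Or.inl h0
  · have := Nat.le_of_dvd h0 h
    exact Or.inr ⟨n - 3, by omega⟩

/-! ### Segments and the action of the letters on them -/

section Segments

variable {N : ℕ} {L : Type*} [LieRing L]

/-- The elements `X_{i, i + r}` (if `N ∤ r`) and `X_{i, i + r} - X_{i + 1, i + r + 1}` (if `N ∣ r`)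
of the algebra, where `X_{a, b} = E_{a, b} - (-1) ^ (b - a) E_{b, a}` in the loop realization. -/
def seg (e : ZMod N → L) : ZMod N → ℕ → L
  | _, 0 => 0
  | i, 1 => e i
  | i, r + 2 => ⁅e i, seg e (i + 1) (r + 1)⁆ + if N ∣ r + 1 then seg e (i + 1) r else 0

variable {e : ZMod N → L}

@[simp]
theorem seg_zero (i : ZMod N) : seg e i 0 = 0 := by simp [seg]

@[simp]
theorem seg_one (i : ZMod N) : seg e i 1 = e i := by simp [seg]

theorem seg_of_ne {n : ℕ} (h : (n : ZMod N) + 1 ≠ 0) (i : ZMod N) :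
    seg e i (n + 2) = ⁅e i, seg e (i + 1) (n + 1)⁆ := by
  rw [seg, if_neg, add_zero]
  rwa [← ZMod.natCast_eq_zero_iff, Nat.cast_add_one]

/-- In the model, when `N ∣ n + 1` the bracket with `e i` also acts at the far end and yields an
extra `-loopX (i + 1) n`; the added term cancels it. -/
theorem seg_of_eq {n : ℕ} (h : (n : ZMod N) + 1 = 0) (i : ZMod N) :
    seg e i (n + 2) = ⁅e i, seg e (i + 1) (n + 1)⁆ + seg e (i + 1) n := by
  rw [seg, if_pos]
  rwa [← ZMod.natCast_eq_zero_iff, Nat.cast_add_one]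

namespace DolanGrady

theorem next (he : DolanGrady e) (i : ZMod N) : ⁅e i, ⁅e i, e (i + 1)⁆⁆ = e (i + 1) :=
  he.adjacent _ _ (Or.inl rfl)

theorem prev (he : DolanGrady e) (i : ZMod N) : ⁅e (i + 1), ⁅e (i + 1), e i⁆⁆ = e i :=
  he.adjacent _ _ (Or.inr rfl)

theorem lie_eq_zero (he : DolanGrady e) {i j : ZMod N} (h1 : j ≠ i + 1) (h2 : i ≠ j + 1) :
    ⁅e i, e j⁆ = 0 :=
  he.not_adjacent _ _ (by simp [Adjacent, h1, h2])

theorem lie_comm (he : DolanGrady e) {i j : ZMod N} (h1 : j ≠ i + 1) (h2 : i ≠ j + 1) (x : L) :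
    ⁅e i, ⁅e j, x⁆⁆ = ⁅e j, ⁅e i, x⁆⁆ := by
  rw [leibniz_lie, he.lie_eq_zero h1 h2, zero_lie, zero_add]

end DolanGrady

variable [LieAlgebra ℂ L]

variable (e) in
/-- The brackets of the generators with the elements `seg e i (n + 1)`. -/
structure SegRel (n : ℕ) : Prop where
  down : (n : ZMod N) + 1 ≠ 0 → (n : ZMod N) ≠ 0 → ∀ i, ⁅e i, seg e i (n + 1)⁆ = seg e (i + 1) n
  down' : (n : ZMod N) + 1 ≠ 0 → (n : ZMod N) ≠ 0 → ∀ i j : ZMod N, j = i + n →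
    ⁅e j, seg e i (n + 1)⁆ = -seg e i n
  diag : (n : ZMod N) = 0 → ∀ i, ⁅e i, seg e i (n + 1)⁆ = -seg e i n
  up' : (n : ZMod N) + 1 ≠ 0 → (n : ZMod N) + 2 ≠ 0 → ∀ i j : ZMod N, j = i + n + 1 →
    ⁅e j, seg e i (n + 1)⁆ = -seg e i (n + 2)
  off : (n : ZMod N) + 1 ≠ 0 → ∀ i j : ZMod N, j + 1 ≠ i → j ≠ i → j ≠ i + n → j ≠ i + n + 1 →
    ⁅e j, seg e i (n + 1)⁆ = 0
  cartan_self : (n : ZMod N) + 1 = 0 → ∀ i : ZMod N,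
    ⁅e i, seg e i (n + 1)⁆ = (-2 : ℂ) • ⁅e i, seg e (i + 1) (n + 1)⁆
  cartan_next : (n : ZMod N) + 1 = 0 → ∀ i : ZMod N,
    ⁅e (i + 1), seg e i (n + 1)⁆ = ⁅e (i + 1), seg e (i + 1 + 1) (n + 1)⁆
  cartan_off : (n : ZMod N) + 1 = 0 → ∀ i j : ZMod N, j + 1 ≠ i → j ≠ i → j ≠ i + 1 →
    ⁅e j, seg e i (n + 1)⁆ = 0

theorem segRel_zero (hN : 3 ≤ N) (he : DolanGrady e) : SegRel e 0 := by
  obtain ⟨u, hu1, hu0, hu2⟩ := exists_one_eq hN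
  have h1 : ((0 : ℕ) : ZMod N) + 1 ≠ 0 := by push_cast; grind
  constructor
  · intro _ h; simp at h
  · intro _ h; simp at h
  · intro _ i; simp
  · rintro _ _ i j rfl
    rw [seg_of_ne h1]
    simp
  · intro _ i j h h' h'' h3
    simp only [zero_add, seg_one]
    exact he.lie_eq_zero (fun h4 => h h4.symm) (by simpa using h3)
  · intro h; exact absurd h h1
  · intro h; exact absurd h h1
  · intro h; exact absurd h h1

section Step

variable {n : ℕ} (hN : 3 ≤ N) (he : DolanGrady e) (H : ∀ k ≤ n, SegRel e k)
include hN he H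

/-- Supplies `haw` and `haw'` of `lie_lie_eq_self_of_cartan`. The correction in `seg_of_eq` writes
each `⁅e j, seg e (j + 1) (p + 3)⁆` as a difference of segments of lengths not divisible by `N`,
whose relations are known. -/
theorem lie_winding {p : ℕ} (hp : p + 3 ≤ n) (h : (p : ZMod N) + 3 = 0) (i : ZMod N) :
    ⁅e i, ⁅e i, seg e (i + 1) (p + 3)⁆⁆ = (-2 : ℂ) • seg e i (p + 3) ∧
    ⁅e i, ⁅e (i + 1), seg e (i + 1 + 1) (p + 3)⁆⁆ = -⁅e (i + 1), ⁅e i, seg e (i + 1) (p + 3)⁆⁆ := by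
  obtain ⟨u, hu1, hu0, hu2⟩ := exists_one_eq hN
  have hw (j : ZMod N) : ⁅e j, seg e (j + 1) (p + 3)⁆ = seg e j (p + 4) - seg e (j + 1) (p + 2) := by
    rw [seg_of_eq (n := p + 2) (by push_cast; grind), add_sub_cancel_right]
  simp only [hw, lie_sub]
  have h1 : ⁅e i, seg e (i + 1) (p + 2)⁆ = seg e i (p + 3) :=
    (seg_of_ne (n := p + 1) (by push_cast; grind) i).symm
  have h2 : ⁅e i, seg e i (p + 4)⁆ = -seg e i (p + 3) :=
    (H (p + 3) hp).diag (by push_cast; grind) i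
  have h3 : ⁅e i, seg e (i + 1) (p + 4)⁆ = seg e i (p + 5) :=
    (seg_of_ne (n := p + 3) (by push_cast; grind) i).symm
  have h4 : ⁅e (i + 1), seg e i (p + 4)⁆ = -seg e i (p + 5) :=
    (H (p + 3) hp).up' (by push_cast; grind) (by push_cast; grind) _ _ (by push_cast; grind)
  have h5 : ⁅e i, seg e (i + 1 + 1) (p + 2)⁆ = -seg e (i + 1 + 1) (p + 1) :=
    (H (p + 1) (by omega)).down' (by push_cast; grind) (by push_cast; grind) _ _
      (by push_cast; grind)
  have h6 : ⁅e (i + 1), seg e (i + 1) (p + 2)⁆ = seg e (i + 1 + 1) (p + 1) :=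
    (H (p + 1) (by omega)).down (by push_cast; grind) (by push_cast; grind) _
  constructor
  · rw [h1, h2]; module
  · rw [h3, h4, h5, h6]; module

theorem lie_lie_winding {p : ℕ} (hp : p + 3 ≤ n) (h : (p : ZMod N) + 3 = 0) (i : ZMod N) :
    ⁅e i, ⁅e i, ⁅e (i + 1), seg e (i + 1 + 1) (p + 3)⁆⁆⁆ =
      ⁅e (i + 1), seg e (i + 1 + 1) (p + 3)⁆ ∧
    ⁅e (i + 1), ⁅e (i + 1), ⁅e i, seg e (i + 1) (p + 3)⁆⁆⁆ = ⁅e i, seg e (i + 1) (p + 3)⁆ := by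
  have h0 : ((p + 2 : ℕ) : ZMod N) + 1 = 0 := by push_cast; grind
  obtain ⟨hw, hw'⟩ := lie_winding hN he H hp h i
  have hs := (H (p + 2) (by omega)).cartan_self h0
  have hn := (H (p + 2) (by omega)).cartan_next h0
  constructor
  · exact lie_lie_eq_self_of_cartan (he.next i) (hn i) (hs i) hw hw'
  · refine lie_lie_eq_self_of_cartan (he.prev i) rfl (hs (i + 1))
      (lie_winding hN he H hp h (i + 1)).1 ?_
    rw [hw', neg_neg]

/-- Unless `N ∣ n`, `e i` kills the part of the segment after its first letter, so `he.next`
decides. If `N ∣ n` and `n > 0`, that part is a winding segment and `lie_lie_winding` replaces this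
argument. -/
theorem lie_lie_seg_left (h1 : (n : ZMod N) + 1 ≠ 0) (h2 : (n : ZMod N) + 2 ≠ 0) (i : ZMod N) :
    ⁅e i, ⁅e i, seg e (i + 1) (n + 1)⁆⁆ = seg e (i + 1) (n + 1) := by
  obtain ⟨u, hu1, hu0, hu2⟩ := exists_one_eq hN
  by_cases h0 : (n : ZMod N) = 0
  · rcases eq_zero_or_exists hN h0 with rfl | ⟨p, rfl⟩
    · simpa using he.next i
    · have hp : (p : ZMod N) + 3 = 0 := by rw [← h0]; push_cast; rfl
      have h3 : ⁅e i, seg e (i + 1 + 1) (p + 2)⁆ = -seg e (i + 1 + 1) (p + 1) :=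
        (H (p + 1) (by omega)).down' (by push_cast; grind) (by push_cast; grind) _ _
          (by push_cast; grind)
      have h4 : ⁅e i, seg e (i + 1 + 1) (p + 1)⁆ = -seg e (i + 1 + 1) (p + 2) :=
        (H p (by omega)).up' (by grind) (by grind) _ _ (by grind)
      rw [seg_of_eq (n := p + 2) (by push_cast; grind), lie_add, lie_add,
        (lie_lie_winding hN he H le_rfl hp i).1, h3, lie_neg, h4, neg_neg]
  · obtain ⟨k, rfl⟩ : ∃ k, n = k + 1 := Nat.exists_eq_succ_of_ne_zero (by rintro rfl; simp at h0)
    have hz : ⁅e i, seg e (i + 1 + 1) (k + 1)⁆ = 0 := by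
      push_cast at *
      exact (H k (by omega)).off h0 _ _ (by grind) (by grind) (by grind) (by grind)
    rw [seg_of_ne (by exact_mod_cast h0), leibniz_lie (e i) (e (i + 1)), hz, lie_zero, add_zero,
      leibniz_lie, hz, lie_zero, add_zero, he.next]

theorem lie_lie_seg_right (h1 : (n : ZMod N) + 1 ≠ 0) (h2 : (n : ZMod N) + 2 ≠ 0)
    (i j : ZMod N) (hj : j = i + n + 1) :
    ⁅e j, ⁅e j, seg e i (n + 1)⁆⁆ = seg e i (n + 1) := by
  obtain ⟨u, hu1, hu0, hu2⟩ := exists_one_eq hN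
  by_cases h0 : (n : ZMod N) = 0
  · obtain rfl : j = i + 1 := by rw [hj, h0, add_zero]
    rcases eq_zero_or_exists hN h0 with rfl | ⟨p, rfl⟩
    · simpa using he.prev i
    · have hp : (p : ZMod N) + 3 = 0 := by rw [← h0]; push_cast; rfl
      have h3 : ⁅e (i + 1), seg e (i + 1) (p + 2)⁆ = seg e (i + 1 + 1) (p + 1) :=
        (H (p + 1) (by omega)).down (by push_cast; grind) (by push_cast; grind) _
      have h4 : ⁅e (i + 1), seg e (i + 1 + 1) (p + 1)⁆ = seg e (i + 1) (p + 2) :=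
        (seg_of_ne (by grind) _).symm
      rw [seg_of_eq (n := p + 2) (by push_cast; grind), lie_add, lie_add,
        (lie_lie_winding hN he H le_rfl hp i).2, h3, h4]
  · obtain ⟨k, rfl⟩ : ∃ k, n = k + 1 := Nat.exists_eq_succ_of_ne_zero (by rintro rfl; simp at h0)
    push_cast at *
    have hz : ⁅e j, seg e i (k + 1)⁆ = 0 :=
      (H k (by omega)).off h0 _ _ (by grind) (by grind) (by grind) (by grind)
    obtain ⟨l, rfl⟩ : ∃ l, j = l + 1 := ⟨j - 1, by ring⟩
    have hs : seg e i (k + 2) = -⁅e l, seg e i (k + 1)⁆ := by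
      rw [(H k (by omega)).up' h0 (by grind) _ l (by grind), neg_neg]
    rw [hs, lie_neg, leibniz_lie (e (l + 1)) (e l), hz, lie_zero, add_zero, lie_neg,
      leibniz_lie, hz, lie_zero, add_zero, he.prev]

end Step
end Segments

/-! ### The induction step for the action of the letters -/

section Segments

variable {N : ℕ} {L : Type*} [LieRing L] [LieAlgebra ℂ L] {e : ZMod N → L}

section Step

variable {n : ℕ} (hN : 3 ≤ N) (he : DolanGrady e) (H : ∀ k ≤ n, SegRel e k)
include hN he H

/-- The winding segment d = `seg e i (n + 1)` is, up to sign, `⁅b, ⁅a, v⁆⁆` with `b = e i`, so `ad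
b` squared multiplies it by 4. By `cartan_self` the main term of `seg_of_eq` then contributes -2d,
and the correction term contributes d. -/
theorem lie_seg_of_cast_eq_one (h : (n : ZMod N) + 1 = 0) (i : ZMod N) :
    ⁅e i, seg e i (n + 2)⁆ = -seg e i (n + 1) := by
  obtain ⟨u, hu1, hu0, hu2⟩ := exists_one_eq hN
  obtain ⟨l, rfl⟩ : ∃ l, n = l + 2 := by
    rcases n with _ | _ | l
    · grind
    · grind
    · exact ⟨l, rfl⟩
  push_cast at h
  obtain ⟨o, rfl⟩ : ∃ o, i = o + 1 := ⟨i - 1, by ring⟩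
  have h1 : ⁅e (o + 1), seg e (o + 1 + 1) (l + 2)⁆ = seg e (o + 1) (l + 3) :=
    (seg_of_ne (n := l + 1) (by push_cast; grind) _).symm
  have h2 : ⁅e (o + 1), seg e (o + 1 + 1) (l + 1)⁆ = seg e (o + 1) (l + 2) :=
    (seg_of_ne (n := l) (by grind) _).symm
  have h3 : ⁅e (o + 1), seg e (o + 1) (l + 2)⁆ = seg e (o + 1 + 1) (l + 1) :=
    (H (l + 1) (by omega)).down (by push_cast; grind) (by push_cast; grind) _
  have h4 : ⁅e o, seg e (o + 1 + 1) (l + 1)⁆ = -seg e (o + 1 + 1) (l + 2) :=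
    (H l (by omega)).up' (by grind) (by grind) _ _ (by grind)
  have h5 := lie_lie_lie_of_involutive (he.prev o) (v := seg e (o + 1 + 1) (l + 1)) (by rw [h2, h3])
  have h6 := (H (l + 2) le_rfl).cartan_self (by push_cast; grind) (o + 1)
  rw [h4, lie_neg, h1, lie_neg, lie_neg, h6, lie_smul] at h5
  rw [seg_of_eq (n := l + 2) (by push_cast; grind), lie_add, h1]
  have h7 : (2 : ℂ) • ⁅e (o + 1), ⁅e (o + 1), seg e (o + 1 + 1) (l + 3)⁆⁆ =
      (2 : ℂ) • ((-2 : ℂ) • seg e (o + 1) (l + 3)) := by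
    linear_combination (norm := module) h5
  rw [smul_right_injective L (by norm_num : (2 : ℂ) ≠ 0) h7]
  module

theorem lie_seg_add_three (h2 : (n : ZMod N) + 2 ≠ 0) (h3 : (n : ZMod N) + 3 ≠ 0) (i j : ZMod N)
    (hj : j = i + n + 2) : ⁅e j, seg e i (n + 2)⁆ = -seg e i (n + 3) := by
  obtain ⟨u, hu1, hu0, hu2⟩ := exists_one_eq hN
  rw [seg_of_ne (n := n + 1) (by push_cast; grind)]
  by_cases h : (n : ZMod N) + 1 = 0
  · obtain ⟨l, rfl⟩ : ∃ l, n = l + 2 := by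
      rcases n with _ | _ | l
      · grind
      · grind
      · exact ⟨l, rfl⟩
    push_cast at h hj
    obtain rfl : j = i + 1 := by grind
    have h4 : ⁅e (i + 1), seg e (i + 1) (l + 2)⁆ = seg e (i + 1 + 1) (l + 1) :=
      (H (l + 1) (by omega)).down (by push_cast; grind) (by push_cast; grind) _
    have h5 : ⁅e i, seg e (i + 1 + 1) (l + 2)⁆ = -seg e (i + 1 + 1) (l + 1) :=
      (H (l + 1) (by omega)).down' (by push_cast; grind) (by push_cast; grind) _ _
        (by push_cast; grind)
    have h6 : ⁅e i, seg e (i + 1 + 1) (l + 1)⁆ = -seg e (i + 1 + 1) (l + 2) :=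
      (H l (by omega)).up' (by grind) (by grind) _ _ (by grind)
    have h7 : ⁅e (i + 1), seg e (i + 1 + 1) (l + 1)⁆ = seg e (i + 1) (l + 2) :=
      (seg_of_ne (n := l) (by grind) _).symm
    have hs := (H (l + 2) le_rfl).cartan_self (by push_cast; grind)
    have h8 := lie_eq_neg_lie_of_cartan (he.next i) (he.prev i) (v := seg e (i + 1 + 1) (l + 1))
      (by rw [h6, lie_neg, h5, neg_neg]) (by rw [h7, h4])
      (by rw [h7, ← seg_of_ne (n := l + 1) (by push_cast; grind)])
      (by rw [h6, lie_neg, neg_neg, ← seg_of_ne (n := l + 1) (by push_cast; grind)])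
      (hs i) ((H (l + 2) le_rfl).cartan_next (by push_cast; grind) i) (hs (i + 1))
    rw [seg_of_eq (n := l + 2) (by push_cast; grind), seg_of_eq (n := l + 2) (by push_cast; grind),
      lie_add, lie_add, h4, h5, h8]
    module
  · rw [seg_of_ne h, he.lie_comm (by grind) (by grind),
      (H n le_rfl).up' h h2 _ j (by grind), lie_neg]

/-- A generic `e j` commutes past `e i`; the interior letter `e (i + 1)` needs
`lie_lie_lie_eq_zero`. When `N ∣ n + 1`, `cartan_self` first moves the bracket onto `seg e i (n +
1)`, where `cartan_off` applies. -/
theorem lie_seg_eq_zero (h2 : (n : ZMod N) + 2 ≠ 0) (i j : ZMod N) (hj : j + 1 ≠ i) (hj' : j ≠ i)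
    (hj1 : j ≠ i + n + 1) (hj2 : j ≠ i + n + 2) : ⁅e j, seg e i (n + 2)⁆ = 0 := by
  obtain ⟨u, hu1, hu0, hu2⟩ := exists_one_eq hN
  by_cases h : (n : ZMod N) + 1 = 0
  · obtain ⟨k, rfl⟩ : ∃ k, n = k + 1 := by
      rcases n with _ | k
      · grind
      · exact ⟨k, rfl⟩
    have h1 : ⁅e i, seg e (i + 1) (k + 2)⁆ = (-1 / 2 : ℂ) • ⁅e i, seg e i (k + 2)⁆ := by
      rw [(H (k + 1) le_rfl).cartan_self h]; module
    have h4 : ⁅e j, seg e i (k + 2)⁆ = 0 :=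
      (H (k + 1) le_rfl).cartan_off h _ _ hj hj' (by grind)
    push_cast at h hj1 hj2
    rw [seg_of_eq (n := k + 1) (by push_cast; grind), lie_add, h1, lie_smul,
      he.lie_comm (by grind) (by grind), h4, lie_zero, smul_zero, zero_add]
    exact (H k (by omega)).off (by grind) _ _ (by grind) (by grind) (by grind) (by grind)
  · rw [seg_of_ne h]
    by_cases hji : j = i + 1
    · subst hji
      obtain ⟨k, rfl⟩ : ∃ k, n = k + 1 := by
        rcases n with _ | k
        · push_cast at hj1; grind
        · exact ⟨k, rfl⟩
      have hd := (H (k + 1) le_rfl).down h (by grind) (i + 1)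
      push_cast at h h2 hj1 hj2
      have hs : seg e (i + 1) (k + 2) = ⁅e (i + 1), seg e (i + 1 + 1) (k + 1)⁆ :=
        seg_of_ne (by grind) _
      rw [hs]
      refine lie_lie_lie_eq_zero (he.prev i) ?_ (by rw [← hs, hd])
      exact (H k (by omega)).off (by grind) _ _ (by grind) (by grind) (by grind) (by grind)
    · rw [he.lie_comm (by grind) (by grind),
        (H n le_rfl).off h _ _ (by grind) (by grind) (by grind) (by grind), lie_zero]

/-- Neighbouring winding segments are, up to sign, `⁅b, ⁅a, v⁆⁆` and `⁅a, ⁅b, v⁆⁆` for adjacent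
letters `a`, `b`, and `lie_lie_of_involutive` compares their brackets with `b = e (i + 1)`. -/
theorem lie_seg_cartan (h : (n : ZMod N) + 2 = 0) (i : ZMod N) :
    ⁅e (i + 1), seg e (i + 1) (n + 2)⁆ = (-2 : ℂ) • ⁅e (i + 1), seg e i (n + 2)⁆ ∧
    ⁅e (i + 1), seg e (i + 1) (n + 2)⁆ = (-2 : ℂ) • ⁅e (i + 1), seg e (i + 1 + 1) (n + 2)⁆ := by
  obtain ⟨u, hu1, hu0, hu2⟩ := exists_one_eq hN
  obtain ⟨k, rfl⟩ : ∃ k, n = k + 1 := by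
    rcases n with _ | k
    · grind
    · exact ⟨k, rfl⟩
  have h1 (j : ZMod N) : seg e j (k + 3) = ⁅e j, seg e (j + 1) (k + 2)⁆ :=
    seg_of_ne (n := k + 1) (by grind) _
  have hdown := (H (k + 1) le_rfl).down (by grind) (by grind) (i + 1)
  have hdown' := (H (k + 1) le_rfl).down' (by grind) (by grind) (i + 1 + 1 + 1) (i + 1) (by grind)
  push_cast at h
  have h2 (j : ZMod N) : seg e j (k + 2) = ⁅e j, seg e (j + 1) (k + 1)⁆ := seg_of_ne (by grind) _
  have hup (j : ZMod N) : ⁅e j, seg e (j + 1 + 1) (k + 1)⁆ = -seg e (j + 1 + 1) (k + 2) :=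
    (H k (by omega)).up' (by grind) (by grind) _ _ (by grind)
  constructor
  · have h3 := lie_lie_of_involutive (he.prev i) (v := seg e (i + 1 + 1) (k + 1))
      (by rw [← h2, hdown])
    rw [hup, lie_neg, ← h1, lie_neg, ← h2, ← h1] at h3
    linear_combination (norm := module) (-1 : ℂ) • h3
  · have h3 := lie_lie_of_involutive (he.next (i + 1)) (v := seg e (i + 1 + 1 + 1) (k + 1))
      (by rw [hup, lie_neg, hdown', neg_neg])
    rw [hup, lie_neg, ← h1, lie_neg, ← h2, ← h1] at h3
    linear_combination (norm := module) h3

theorem segRel_succ : SegRel e (n + 1) := by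
  obtain ⟨u, hu1, hu0, hu2⟩ := exists_one_eq hN
  constructor
  · intro h1 h2 i
    push_cast at h1 h2
    rw [seg_of_ne h2, lie_lie_seg_left hN he H h2 (by grind)]
  · rintro h1 h2 i j hj
    push_cast at h1 h2 hj
    rw [← neg_neg (seg e i (n + 1 + 1)), ← (H n le_rfl).up' h2 (by grind) i j (by grind), lie_neg,
      lie_lie_seg_right hN he H h2 (by grind) i j (by grind)]
  · intro h i
    push_cast at h
    exact lie_seg_of_cast_eq_one hN he H h i
  · rintro h1 h2 i j hj
    push_cast at h1 h2 hj
    exact lie_seg_add_three hN he H (by grind) (by grind) i j (by grind)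
  · intro h1 i j hj hj' hj1 hj2
    push_cast at h1 hj1 hj2
    exact lie_seg_eq_zero hN he H (by grind) i j hj hj' (by grind) (by grind)
  · intro h i
    push_cast at h
    obtain ⟨o, rfl⟩ : ∃ o, i = o + 1 := ⟨i - 1, by ring⟩
    exact (lie_seg_cartan hN he H (by grind) o).2
  · intro h i
    push_cast at h
    obtain ⟨h1, h2⟩ := lie_seg_cartan hN he H (by grind) i
    exact smul_right_injective L (by norm_num : (-2 : ℂ) ≠ 0) (h1.symm.trans h2)
  · intro h i j hj hj' hj1
    push_cast at h
    rw [seg_of_ne (by grind), he.lie_comm (fun h => hj h.symm) hj1,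
      (H n le_rfl).off (by grind) _ _ (by grind) (by grind) (by grind) (by grind), lie_zero]

end Step

theorem segRel (hN : 3 ≤ N) (he : DolanGrady e) (n : ℕ) : SegRel e n := by
  induction n using Nat.strong_induction_on with
  | _ n ih =>
    rcases n with _ | n
    · exact segRel_zero hN he
    · exact segRel_succ hN he fun k hk => ih k (by omega)

end Segments

/-! ### Discrete integration around the cycle -/

section Primitive

variable {N : ℕ} {M : Type*} [AddCommGroup M]

theorem sum_range_natCast_add [NeZero N] (f : ZMod N → M) (a : ZMod N) :
    ∑ k ∈ Finset.range N, f (a + k) = ∑ b, f b := by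
  refine Finset.sum_bij' (fun k _ => a + k) (fun b _ => (b - a).val) ?_ ?_ ?_ ?_ ?_
  · simp
  · intro b _; simpa using ZMod.val_lt (b - a)
  · intro k hk; simpa using ZMod.val_cast_of_lt (Finset.mem_range.mp hk)
  · intro b _; simp
  · intro k _; rfl

variable [Module ℂ M]

/-- A right inverse, up to a constant, of the difference operator `g ↦ g a - g (a + 1)`. -/
noncomputable def primitive (f : ZMod N → M) (a : ZMod N) : M :=
  -((N : ℂ)⁻¹ • ∑ k ∈ Finset.range N, (k : ℂ) • f (a + k))

/-- Summation by parts: after one turn the boundary terms return to `f a`, and what remains is the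
mean of `f`. -/
theorem primitive_sub [NeZero N] (f : ZMod N → M) (a : ZMod N) :
    primitive (fun b => f b - f (b + 1)) a = f a - (N : ℂ)⁻¹ • ∑ b, f b := by
  have hN : (N : ℂ) ≠ 0 := Nat.cast_ne_zero.mpr (NeZero.ne N)
  have h : ∀ n : ℕ, ∑ k ∈ Finset.range n, (k : ℂ) • (f (a + k) - f (a + k + 1)) =
      (∑ k ∈ Finset.range n, f (a + k)) - (n : ℂ) • f (a + n) + f (a + n) - f a := by
    intro n
    induction n with
    | zero => simp
    | succ n ih =>
      rw [Finset.sum_range_succ, ih, Finset.sum_range_succ, Nat.cast_succ, Nat.cast_succ, add_assoc a]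
      module
  rw [primitive, h, sum_range_natCast_add, ZMod.natCast_self, add_zero]
  have h1 : (N : ℂ)⁻¹ • (N : ℂ) • f a = f a := inv_smul_smul₀ hN _
  linear_combination (norm := module) h1

theorem primitive_sub_primitive [NeZero N] (f : ZMod N → M) (a : ZMod N) :
    primitive f a - primitive f (a + 1) = f a - (N : ℂ)⁻¹ • ∑ b, f b := by
  rw [← primitive_sub]
  simp only [primitive, smul_sub, Finset.sum_sub_distrib, add_right_comm a 1]
  module

theorem primitive_zero (a : ZMod N) : primitive (fun _ => (0 : M)) a = 0 := by
  simp [primitive]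

theorem map_primitive {M' : Type*} [AddCommGroup M'] [Module ℂ M'] (g : M →ₗ[ℂ] M')
    (f : ZMod N → M) (a : ZMod N) : g (primitive f a) = primitive (fun b => g (f b)) a := by
  simp [primitive]

end Primitive

/-! ### Normalized segments and the action of the letters modulo central sums -/

section Hat

variable {N : ℕ} [NeZero N] {L : Type*} [LieRing L] [LieAlgebra ℂ L] (e : ZMod N → L)

/-- The image of `X_{a, a + n}` in the algebra, where the elements with `N ∣ n` are normalized by
subtracting a multiple of the identity matrix. -/
noncomputable def hat (a : ZMod N) (n : ℕ) : L :=
  if (n : ZMod N) = 0 then primitive (fun b => seg e b n) a else seg e a n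

/-- The image of `X_{a, a + r}`, using `X_{b, a} = -(-1) ^ (b - a) X_{a, b}` for negative `r`. -/
noncomputable def hatInt (a : ZMod N) : ℤ → L
  | Int.ofNat n => hat e a n
  | Int.negSucc n => (-1 : ℂ) ^ n • hat e (a - (n + 1)) (n + 1)

variable {e}

theorem hat_zero (a : ZMod N) : hat e a 0 = 0 := by simp [hat, primitive_zero]

theorem hat_of_ne {n : ℕ} (h : (n : ZMod N) ≠ 0) (a : ZMod N) : hat e a n = seg e a n := if_neg h

theorem hat_sub_hat {n : ℕ} (h : (n : ZMod N) = 0) (a : ZMod N) :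
    hat e a n - hat e (a + 1) n = seg e a n - (N : ℂ)⁻¹ • ∑ b, seg e b n := by
  rw [hat, hat, if_pos h, if_pos h, primitive_sub_primitive]

variable (e) in
/-- The element `⁅e j, seg e (j + 1) (n + 1)⁆` when `N ∣ n + 1`. -/
def winding (j : ZMod N) (n : ℕ) : L := seg e j (n + 2) - seg e (j + 1) n

/-- The coefficients 1, -2, 1 are a row of the affine Cartan matrix, up to sign. Writing them as a
difference of consecutive values in `b` lets the sum telescope in `lie_sum_seg` and lets
`primitive_sub` integrate in `lie_hat_of_eq`. -/
theorem lie_seg_of_eq (hN : 3 ≤ N) (he : DolanGrady e) {n : ℕ} (h : (n : ZMod N) + 1 = 0)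
    (b j : ZMod N) : ⁅e j, seg e b (n + 1)⁆ =
      ((if j + 1 = b then winding e j n else 0) - (if j = b then winding e j n else 0)) -
        ((if j + 1 = b + 1 then winding e j n else 0) -
          (if j = b + 1 then winding e j n else 0)) := by
  obtain ⟨u, hu1, hu0, hu2⟩ := exists_one_eq hN
  have H := segRel hN he n
  have hw' : winding e j n = ⁅e j, seg e (j + 1) (n + 1)⁆ := by
    rw [winding, seg_of_eq h, add_sub_cancel_right]
  by_cases hb1 : j + 1 = b
  · subst hb1
    rw [← hw', if_pos rfl, if_neg (by grind), if_neg (by grind), if_neg (by grind)]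
    module
  by_cases hb2 : j = b
  · subst hb2
    have h3 : j ≠ j + 1 := by grind
    simp only [H.cartan_self h, ← hw', hb1, h3, if_true, if_false]
    module
  by_cases hb3 : j = b + 1
  · subst hb3
    rw [H.cartan_next h, ← hw', if_pos rfl, if_neg (by grind), if_neg (by grind),
      if_neg (by grind)]
    module
  rw [H.cartan_off h _ _ hb1 hb2 hb3, if_neg hb1, if_neg hb2, if_neg hb3, if_neg (by grind)]
  module

theorem lie_sum_seg (hN : 3 ≤ N) (he : DolanGrady e) {n : ℕ} (h : (n : ZMod N) + 1 = 0)
    (j : ZMod N) : ⁅e j, ∑ b, seg e b (n + 1)⁆ = 0 := by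
  rw [lie_sum]
  simp only [lie_seg_of_eq hN he h]
  rw [Finset.sum_sub_distrib, sub_eq_zero]
  exact (Equiv.sum_comp (Equiv.addRight (1 : ZMod N)) fun b =>
    (if j + 1 = b then winding e j n else 0) - (if j = b then winding e j n else 0)).symm

theorem lie_hat_of_eq (hN : 3 ≤ N) (he : DolanGrady e) {n : ℕ} (h : (n : ZMod N) + 1 = 0)
    (a j : ZMod N) : ⁅e j, hat e a (n + 1)⁆ =
      (if j + 1 = a then winding e j n else 0) - (if j = a then winding e j n else 0) := by
  have h1 := map_primitive (LieModule.toEnd ℂ L L (e j)) (fun b => seg e b (n + 1)) a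
  simp only [LieModule.toEnd_apply_apply, lie_seg_of_eq hN he h] at h1
  rw [hat, if_pos (by exact_mod_cast h), h1, primitive_sub (f := fun b =>
    (if j + 1 = b then winding e j n else 0) - (if j = b then winding e j n else 0))]
  simp

theorem hatInt_neg (a : ZMod N) (n : ℕ) :
    hatInt e a (-(n : ℤ)) = -(-1 : ℂ) ^ n • hat e (a - n) n := by
  rcases n with _ | n
  · simp [hatInt, hat_zero]
  · change (-1 : ℂ) ^ n • hat e (a - (n + 1)) (n + 1) = _
    rw [pow_succ, Nat.cast_succ]
    module

variable {C : Submodule ℂ L} (hC : ∀ n : ℕ, (n : ZMod N) = 0 → ∑ b, seg e b n ∈ C)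
include hC

/-- The `hat` elements obey the rule of `lie_loopGen_loopX` up to multiples of the sums of segments.
The submodule `C` stays free because it is taken first to be the centre and later `⊥`. -/
theorem lie_hat_sub_mem (hN : 3 ≤ N) (he : DolanGrady e) (n : ℕ) (a j : ZMod N) :
    ⁅e j, hat e a (n + 1)⁆ - ((if j + 1 = a then hat e j (n + 2) else 0) +
      (if j = a then hat e (j + 1) n else 0) - (if a + n + 1 = j then hat e a (n + 2) else 0) -
      (if a + n = j then hat e a n else 0)) ∈ C := by
  obtain ⟨u, hu1, hu0, hu2⟩ := exists_one_eq hN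
  have H := segRel hN he n
  by_cases h : (n : ZMod N) + 1 = 0
  · rw [lie_hat_of_eq hN he h, winding, hat_of_ne (n := n) (by grind), hat_of_ne (n := n) (by grind),
      hat_of_ne (n := n + 2) (by push_cast; grind), hat_of_ne (n := n + 2) (by push_cast; grind)]
    convert C.zero_mem
    by_cases h1 : j + 1 = a
    · subst h1
      rw [if_pos rfl, if_pos rfl, if_neg (by grind), if_neg (by grind), if_neg (by grind),
        if_pos (by grind)]
      module
    by_cases h2 : j = a
    · subst h2
      rw [if_pos rfl, if_pos rfl, if_neg (by grind), if_neg (by grind), if_pos (by grind),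
        if_neg (by grind)]
      module
    rw [if_neg h1, if_neg h1, if_neg h2, if_neg h2, if_neg (by grind), if_neg (by grind)]
    module
  rw [hat_of_ne (n := n + 1) (by exact_mod_cast h)]
  by_cases h1 : j + 1 = a
  · subst h1
    rw [if_pos rfl, if_neg (by grind), if_neg (by grind : ¬ j + 1 + (n : ZMod N) = j),
      ← seg_of_ne h]
    by_cases h2 : (n : ZMod N) + 2 = 0
    · have h3 := hat_sub_hat (e := e) (n := n + 2) (by push_cast; exact h2) j
      rw [if_pos (by grind)]
      rw [show seg e j (n + 2) - (hat e j (n + 2) + 0 - hat e (j + 1) (n + 2) - 0) =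
        (N : ℂ)⁻¹ • ∑ b, seg e b (n + 2) by linear_combination (norm := module) (-1 : ℂ) • h3]
      exact C.smul_mem _ (hC _ (by push_cast; exact h2))
    · rw [if_neg (by grind), hat_of_ne (by push_cast; exact h2)]
      convert C.zero_mem
      module
  by_cases h2 : j = a
  · subst h2
    rw [if_neg h1, if_pos rfl, if_neg (by grind)]
    by_cases h3 : (n : ZMod N) = 0
    · rw [if_pos (by grind), H.diag h3]
      rw [show -seg e j n - (0 + hat e (j + 1) n - 0 - hat e j n) =
        -((N : ℂ)⁻¹ • ∑ b, seg e b n) by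
          linear_combination (norm := module) hat_sub_hat (e := e) h3 j]
      exact C.neg_mem (C.smul_mem _ (hC _ h3))
    · rw [if_neg (by grind), H.down h h3, hat_of_ne h3]
      convert C.zero_mem
      module
  rw [if_neg h1, if_neg h2]
  convert C.zero_mem
  by_cases h3 : a + n = j
  · rw [if_pos h3, if_neg (by grind), hat_of_ne (by grind), H.down' h (by grind) _ _ h3.symm]
    module
  by_cases h4 : a + n + 1 = j
  · rw [if_pos h4, if_neg h3, hat_of_ne (by push_cast; grind), H.up' h (by grind) _ _ h4.symm]
    module
  rw [if_neg h3, if_neg h4, H.off h _ _ h1 h2 (Ne.symm h3) (Ne.symm h4)]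
  module

theorem lie_hatInt_sub_mem (hN : 3 ≤ N) (he : DolanGrady e) (r : ℤ) (a j : ZMod N) :
    ⁅e j, hatInt e a r⁆ - ((if j + 1 = a then hatInt e j (r + 1) else 0) +
      (if j = a then hatInt e (j + 1) (r - 1) else 0) -
      (if a + r = j then hatInt e a (r + 1) else 0) -
      (if a + r = j + 1 then hatInt e a (r - 1) else 0)) ∈ C := by
  obtain ⟨u, hu1, hu0, hu2⟩ := exists_one_eq hN
  have hneg := hatInt_neg (e := e)
  have hpos (b : ZMod N) (n : ℕ) : hatInt e b n = hat e b n := rfl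
  rcases r with (_ | n) | n
  · convert C.zero_mem
    have h1 := hneg a 1
    have h2 := hneg (j + 1) 1
    have h3 := hpos j 1
    have h4 := hpos a 1
    have h5 := hpos a 0
    simp only [Nat.cast_one, Nat.cast_zero, hat_zero] at h1 h2 h3 h4 h5
    simp only [Int.ofNat_eq_natCast, Nat.cast_zero, zero_add, zero_sub, Int.cast_zero, add_zero,
      h1, h2, h3, h4, h5, lie_zero]
    by_cases h6 : j + 1 = a
    · subst h6
      rw [if_pos rfl, if_pos rfl, if_neg (by grind), if_neg (by grind), add_sub_cancel_right j 1]
      module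
    by_cases h7 : j = a
    · subst h7
      rw [if_pos rfl, if_pos rfl, if_neg (by grind), if_neg (by grind), add_sub_cancel_right j 1]
      module
    rw [if_neg h6, if_neg h7, if_neg (Ne.symm h7), if_neg (Ne.symm h6)]
    module
  · have h := lie_hat_sub_mem hC hN he n a j
    rw [Int.ofNat_eq_natCast, show ((n + 1 : ℕ) : ℤ) + 1 = ((n + 2 : ℕ) : ℤ) by push_cast; ring,
      show ((n + 1 : ℕ) : ℤ) - 1 = (n : ℤ) by push_cast; ring]
    simp only [hpos]
    have c1 : a + (((n + 1 : ℕ) : ℤ) : ZMod N) = j ↔ a + n + 1 = j := by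
      push_cast; rw [← add_assoc]
    have c2 : a + (((n + 1 : ℕ) : ℤ) : ZMod N) = j + 1 ↔ a + n = j := by
      push_cast; rw [← add_assoc, add_left_inj]
    simpa only [c1, c2] using h
  · have h := C.smul_mem ((-1 : ℂ) ^ n) (lie_hat_sub_mem hC hN he n (a - (n + 1)) j)
    rw [Int.negSucc_eq, show -((n : ℤ) + 1) + 1 = -(n : ℤ) by ring,
      show -((n : ℤ) + 1) - 1 = -((n + 2 : ℕ) : ℤ) by push_cast; ring,
      show -((n : ℤ) + 1) = -((n + 1 : ℕ) : ℤ) by push_cast; ring]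
    simp only [hneg]
    have c1 : a + (((-((n + 1 : ℕ) : ℤ)) : ℤ) : ZMod N) = j ↔ j = a - (n + 1) := by
      push_cast; rw [← sub_eq_add_neg, eq_comm]
    have c2 : a + (((-((n + 1 : ℕ) : ℤ)) : ℤ) : ZMod N) = j + 1 ↔ j + 1 = a - (n + 1) := by
      push_cast; rw [← sub_eq_add_neg, eq_comm]
    have c3 : a - (n + 1) + n + 1 = j ↔ j = a := by constructor <;> intro h <;> grind
    have c4 : a - (n + 1) + n = j ↔ j + 1 = a := by constructor <;> intro h <;> grind
    simp only [c1, c2]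
    simp only [c3, c4] at h
    convert h using 1
    push_cast
    have d1 : (if j + 1 = a then -(-1 : ℂ) ^ n • hat e (j - n) n else 0) =
        -(-1 : ℂ) ^ n • (if j + 1 = a then hat e (a - (n + 1)) n else 0) := by
      split_ifs with h1
      · rw [← h1, add_sub_add_right_eq_sub]
      · simp
    have d2 : (if j = a then -(-1 : ℂ) ^ (n + 2) • hat e (j + 1 - (n + 2)) (n + 2) else 0) =
        -(-1 : ℂ) ^ n • (if j = a then hat e (a - (n + 1)) (n + 2) else 0) := by
      split_ifs with h1
      · rw [← h1, show j + 1 - ((n : ZMod N) + 2) = j - (n + 1) by ring, pow_add]; module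
      · simp
    have d3 : (if j = a - (n + 1) then -(-1 : ℂ) ^ n • hat e (a - n) n else 0) =
        -(-1 : ℂ) ^ n • (if j = a - (n + 1) then hat e (j + 1) n else 0) := by
      split_ifs with h1
      · rw [h1, sub_add_eq_add_sub, add_sub_add_right_eq_sub]
      · simp
    have d4 : (if j + 1 = a - (n + 1) then -(-1 : ℂ) ^ (n + 2) • hat e (a - (n + 2)) (n + 2) else 0) =
        -(-1 : ℂ) ^ n • (if j + 1 = a - (n + 1) then hat e j (n + 2) else 0) := by
      split_ifs with h1
      · rw [show a - ((n : ZMod N) + 2) = j by grind, pow_add]; module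
      · simp
    rw [d1, d2, d3, d4, lie_smul, pow_succ]
    module

end Hat

/-- Matrices over the Laurent polynomials, indexed by the vertices of the cycle. -/
abbrev LoopMatrix (N : ℕ) : Type := Matrix (ZMod N) (ZMod N) ℂ[T;T⁻¹]

/-! ### The matrix model -/

section LoopMatrix

variable {N : ℕ}

/-- The matrix unit `E_{a, b}` with the weight `T ^ r`. -/
noncomputable def matUnit (a b : ZMod N) (r : ℤ) : LoopMatrix N := Matrix.single a b (T r)

/-- The generators in the loop realization, in the principal gauge. -/
noncomputable def loopGen (j : ZMod N) : LoopMatrix N := matUnit j (j + 1) 1 + matUnit (j + 1) j (-1)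

/-- The element `E_{a, a + r} - (-1) ^ r E_{a + r, a}`. -/
noncomputable def loopX (a : ZMod N) (r : ℕ) : LoopMatrix N :=
  matUnit a (a + (r : ZMod N)) r - (-1 : ℂ) ^ r • matUnit (a + (r : ZMod N)) a (-r)

variable [NeZero N]

theorem matUnit_mul (a b c d : ZMod N) (r q : ℤ) :
    matUnit a b r * matUnit c d q = if b = c then matUnit a d (r + q) else 0 := by
  split_ifs with h
  · subst h
    rw [matUnit, matUnit, matUnit, Matrix.single_mul_single_same, LaurentPolynomial.T_add]
  · exact Matrix.single_mul_single_of_ne _ _ _ _ h _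

theorem lie_matUnit (j a b : ZMod N) (r : ℤ) : ⁅loopGen j, matUnit a b r⁆ =
    (if j + 1 = a then matUnit j b (r + 1) else 0) +
      (if j = a then matUnit (j + 1) b (r - 1) else 0) -
      (if b = j then matUnit a (j + 1) (r + 1) else 0) -
      (if b = j + 1 then matUnit a j (r - 1) else 0) := by
  rw [LieRing.of_associative_ring_bracket, loopGen, add_mul, mul_add]
  simp only [matUnit_mul, add_comm (1 : ℤ), add_comm (-1 : ℤ), ← sub_eq_add_neg]
  abel

theorem loopX_eq {a b : ZMod N} {r : ℕ} (h : a + r = b) :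
    loopX a r = matUnit a b r - (-1 : ℂ) ^ r • matUnit b a (-r) := by
  rw [loopX, h]

theorem lie_loopGen_loopX (n : ℕ) (j a : ZMod N) : ⁅loopGen j, loopX a (n + 1)⁆ =
    (if j + 1 = a then loopX j (n + 2) else 0) + (if j = a then loopX (j + 1) n else 0) -
      (if a + n + 1 = j then loopX a (n + 2) else 0) - (if a + n = j then loopX a n else 0) := by
  obtain ⟨b, hb⟩ : ∃ b, a + n + 1 = b := ⟨_, rfl⟩
  have i1 : ((n + 1 : ℕ) : ℤ) + 1 = ((n + 2 : ℕ) : ℤ) := by push_cast; ring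
  have i2 : ((n + 1 : ℕ) : ℤ) - 1 = (n : ℤ) := by push_cast; ring
  have i3 : -((n + 1 : ℕ) : ℤ) + 1 = -(n : ℤ) := by push_cast; ring
  have i4 : -((n + 1 : ℕ) : ℤ) - 1 = -((n + 2 : ℕ) : ℤ) := by push_cast; ring
  rw [loopX_eq (b := b) (by rw [← hb]; push_cast; ring), lie_sub, lie_smul, lie_matUnit, lie_matUnit,
    hb, i1, i2, i3, i4]
  have d1 : (if j + 1 = a then loopX j (n + 2) else 0) =
      (if j + 1 = a then matUnit j b ((n + 2 : ℕ) : ℤ) else 0) -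
        (-1 : ℂ) ^ n • (if a = j + 1 then matUnit b j (-((n + 2 : ℕ) : ℤ)) else 0) := by
    by_cases h : j + 1 = a
    · rw [if_pos h, if_pos h, if_pos h.symm, loopX_eq (b := b) (by push_cast; grind), pow_add]
      module
    · rw [if_neg h, if_neg h, if_neg (Ne.symm h)]; module
  have d2 : (if j = a then loopX (j + 1) n else 0) =
      (if j = a then matUnit (j + 1) b (n : ℤ) else 0) -
        (-1 : ℂ) ^ n • (if a = j then matUnit b (j + 1) (-(n : ℤ)) else 0) := by
    by_cases h : j = a
    · rw [if_pos h, if_pos h, if_pos h.symm, loopX_eq (b := b) (by grind)]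
    · rw [if_neg h, if_neg h, if_neg (Ne.symm h)]; module
  have d3 : (if b = j then loopX a (n + 2) else 0) =
      (if b = j then matUnit a (j + 1) ((n + 2 : ℕ) : ℤ) else 0) -
        (-1 : ℂ) ^ n • (if j = b then matUnit (j + 1) a (-((n + 2 : ℕ) : ℤ)) else 0) := by
    by_cases h : b = j
    · rw [if_pos h, if_pos h, if_pos h.symm, loopX_eq (b := j + 1) (by push_cast; grind), pow_add]
      module
    · rw [if_neg h, if_neg h, if_neg (Ne.symm h)]; module
  have d4 : (if a + n = j then loopX a n else 0) =
      (if b = j + 1 then matUnit a j (n : ℤ) else 0) -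
        (-1 : ℂ) ^ n • (if j + 1 = b then matUnit j a (-(n : ℤ)) else 0) := by
    by_cases h : a + n = j
    · rw [if_pos h, if_pos (by grind), if_pos (by grind), loopX_eq h]
    · rw [if_neg h, if_neg (by grind), if_neg (by grind)]; module
  rw [d1, d2, d3, d4, pow_succ]
  module

theorem seg_loopGen (hN : 3 ≤ N) (r : ℕ) (i : ZMod N) : seg loopGen i r =
    if (r : ZMod N) = 0 then loopX i r - loopX (i + 1) r else loopX i r := by
  obtain ⟨u, hu1, hu0, hu2⟩ := exists_one_eq hN
  induction r using Nat.strong_induction_on generalizing i with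
  | _ r ih =>
    rcases r with _ | _ | n
    · simp [loopX]
    · have h1 : ((1 : ℕ) : ZMod N) ≠ 0 := by push_cast; grind
      rw [zero_add, if_neg h1]
      simp [loopX, loopGen]
    · by_cases h : (n : ZMod N) + 1 = 0
      · rw [seg_of_eq h, ih (n + 1) (by omega), ih n (by omega), if_pos (by exact_mod_cast h),
          if_neg (by grind), if_neg (by push_cast; grind), lie_sub, lie_loopGen_loopX,
          lie_loopGen_loopX, if_pos rfl, if_neg (by grind), if_neg (by grind), if_pos (by grind),
          if_neg (by grind), if_neg (by grind), if_neg (by grind), if_neg (by grind)]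
        abel
      · rw [seg_of_ne h, ih (n + 1) (by omega), if_neg (by exact_mod_cast h), lie_loopGen_loopX,
          if_pos rfl, if_neg (by grind : ¬ i = i + 1), if_neg (by grind : ¬ i + 1 + (n : ZMod N) = i)]
        by_cases h2 : (n : ZMod N) + 2 = 0
        · rw [if_pos (by grind), if_pos (by push_cast; grind)]
          abel
        · rw [if_neg (by grind), if_neg (by push_cast; grind)]
          abel

theorem lie_loopX (a b c : ZMod N) (r q : ℕ) (hb : b = a + r) (hc : c = b + q) (hab : a ≠ b)
    (hbc : b ≠ c) (hac : a ≠ c) : ⁅loopX a r, loopX b q⁆ = loopX a (r + q) := by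
  have h1 : a + ((r + q : ℕ) : ZMod N) = c := by rw [hc, hb]; push_cast; ring
  rw [LieRing.of_associative_ring_bracket, loopX, loopX, loopX, ← hb, ← hc, h1]
  simp only [sub_mul, mul_sub, Algebra.smul_mul_assoc, Algebra.mul_smul_comm, matUnit_mul, hab, hbc,
    hac, hab.symm, hbc.symm, hac.symm, if_true, if_false]
  push_cast
  rw [neg_add_rev, pow_add]
  module

end LoopMatrix

/-! ### The map from the model back to the algebra -/

section Realize

variable {N : ℕ} [NeZero N] {L : Type*} [LieRing L] [LieAlgebra ℂ L] (e : ZMod N → L)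

/-- The linear map from the loop realization to the algebra, which on the Lie subalgebra generated
by the matrices `loopGen j` turns out to be a Lie algebra homomorphism. -/
noncomputable def realize : LoopMatrix N →ₗ[ℂ] L :=
  Matrix.liftLinear ℂ fun a b => (Finsupp.linearCombination ℂ fun r : ℤ =>
    if b = a + r then (2⁻¹ : ℂ) • hatInt e a r else 0) ∘ₗ
      (AddMonoidAlgebra.coeffLinearEquiv ℂ).toLinearMap

variable {e}

theorem realize_matUnit (a b : ZMod N) (r : ℤ) : realize e (matUnit a b r) =
    if b = a + r then (2⁻¹ : ℂ) • hatInt e a r else 0 := by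
  rw [realize, matUnit, Matrix.liftLinear_single]
  change Finsupp.linearCombination ℂ _ (Finsupp.single r 1) = _
  rw [Finsupp.linearCombination_single, one_smul]

/-- The sign in `hatInt` at `-r` cancels the one in `loopX`, so both matrix units contribute half of
`hat e a r`; hence the factor 1/2 in `realize`. -/
theorem realize_loopX (a : ZMod N) (r : ℕ) : realize e (loopX a r) = hat e a r := by
  have h1 : ((-1 : ℂ) ^ r) * (-1) ^ r = 1 := by rw [← mul_pow]; simp
  have h2 : hatInt e a (r : ℤ) = hat e a r := rfl
  rw [loopX, map_sub, map_smul, realize_matUnit, realize_matUnit, if_pos (by simp),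
    if_pos (by simp), hatInt_neg, h2, add_sub_cancel_right, smul_smul, smul_smul,
    ← sub_smul]
  convert one_smul ℂ (hat e a r)
  linear_combination h1 / 2

variable {C : Submodule ℂ L} (hC : ∀ n : ℕ, (n : ZMod N) = 0 → ∑ b, seg e b n ∈ C)
include hC

theorem lie_realize_sub_mem (hN : 3 ≤ N) (he : DolanGrady e) (j : ZMod N) (x : LoopMatrix N) :
    ⁅e j, realize e x⁆ - realize e ⁅loopGen j, x⁆ ∈ C := by
  let Φ : LoopMatrix N →ₗ[ℂ] L := LieModule.toEnd ℂ L L (e j) ∘ₗ realize e -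
    realize e ∘ₗ LieModule.toEnd ℂ (LoopMatrix N) (LoopMatrix N) (loopGen j)
  change x ∈ C.comap Φ
  rw [Matrix.matrix_eq_sum_single x]
  refine Submodule.sum_mem _ fun a _ => Submodule.sum_mem _ fun b _ => ?_
  induction x a b using AddMonoidAlgebra.induction_linear with
  | zero => rw [Matrix.single_zero]; exact Submodule.zero_mem _
  | add p q hp hq => rw [Matrix.single_add]; exact Submodule.add_mem _ hp hq
  | single r c =>
    have h1 : Matrix.single a b (AddMonoidAlgebra.single r c) = c • matUnit a b r := by
      rw [matUnit, Matrix.smul_single, LaurentPolynomial.smul_eq_C_mul,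
        LaurentPolynomial.single_eq_C_mul_T]
    rw [h1]
    refine Submodule.smul_mem _ _ ?_
    change ⁅e j, realize e (matUnit a b r)⁆ - realize e ⁅loopGen j, matUnit a b r⁆ ∈ C
    rw [lie_matUnit, map_sub, map_sub, map_add]
    simp only [apply_ite (realize e), map_zero, realize_matUnit]
    by_cases h : b = a + r
    · have h2 := C.smul_mem (2⁻¹ : ℂ) (lie_hatInt_sub_mem hC hN he r a j)
      rw [smul_sub, smul_sub, smul_sub, smul_add, ← lie_smul] at h2
      simp only [smul_ite, smul_zero] at h2
      rw [← h] at h2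
      have h3 {p q : Prop} [Decidable p] [Decidable q] (hpq : p → q) (y : L) :
          (if p then if q then y else 0 else 0) = if p then y else 0 := by
        by_cases hp : p
        · rw [if_pos hp, if_pos hp, if_pos (hpq hp)]
        · rw [if_neg hp, if_neg hp]
      rw [if_pos h, h3, h3, h3, h3]
      · exact h2
      all_goals
        intro h4
        push_cast
        grind
    · have h2 {p q : Prop} [Decidable p] [Decidable q] (hpq : p → ¬ q) (y : L) :
          (if p then if q then y else 0 else 0) = 0 := by
        by_cases hp : p
        · rw [if_pos hp, if_neg (hpq hp)]
        · rw [if_neg hp]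
      rw [if_neg h, h2, h2, h2, h2, lie_zero]
      · simp
      all_goals
        intro h3
        push_cast
        grind

omit hC in
-- Compatibility passes from the generators to brackets by Jacobi, as errors in `C` are killed by
-- further brackets.
theorem lie_realize_sub_mem_of_mem (hC0 : ∀ c ∈ C, ∀ y : L, ⁅y, c⁆ = 0)
    (h : ∀ (j : ZMod N) (x : LoopMatrix N), ⁅e j, realize e x⁆ - realize e ⁅loopGen j, x⁆ ∈ C)
    (hj : ∀ j, realize e (loopGen j) = e j) {y : LoopMatrix N}
    (hy : y ∈ LieSubalgebra.lieSpan ℂ (LoopMatrix N) (Set.range loopGen)) (x : LoopMatrix N) :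
    ⁅realize e y, realize e x⁆ - realize e ⁅y, x⁆ ∈ C := by
  induction hy using LieSubalgebra.lieSpan_induction generalizing x with
  | mem y hy => obtain ⟨j, rfl⟩ := hy; rw [hj]; exact h j x
  | zero => simp
  | add y z _ _ hy hz =>
    rw [map_add, add_lie, add_lie, map_add, add_sub_add_comm]
    exact C.add_mem (hy x) (hz x)
  | smul c y _ hy =>
    rw [map_smul, smul_lie, smul_lie, map_smul, ← smul_sub]
    exact C.smul_mem _ (hy x)
  | lie y z _ _ hy hz =>
    have h1 : ⁅realize e ⁅y, z⁆, realize e x⁆ = ⁅⁅realize e y, realize e z⁆, realize e x⁆ := by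
      rw [← sub_eq_zero, ← sub_lie, ← neg_sub, neg_lie, ← lie_skew, hC0 _ (hy z), neg_zero, neg_zero]
    have h2 (y z x : LoopMatrix N) (hy : ∀ x, ⁅realize e y, realize e x⁆ - realize e ⁅y, x⁆ ∈ C)
        (hz : ⁅realize e z, realize e x⁆ - realize e ⁅z, x⁆ ∈ C) :
        ⁅realize e y, ⁅realize e z, realize e x⁆⁆ - realize e ⁅y, ⁅z, x⁆⁆ ∈ C := by
      have h3 : ⁅realize e y, ⁅realize e z, realize e x⁆⁆ = ⁅realize e y, realize e ⁅z, x⁆⁆ := by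
        rw [← sub_eq_zero, ← lie_sub, hC0 _ hz]
      rw [h3]
      exact hy _
    rw [h1, lie_lie, lie_lie, map_sub, sub_sub_sub_comm]
    exact C.sub_mem (h2 y z x hy (hz x)) (h2 z y x hz (hy x))

end Realize

/-! ### Vanishing of the central sums and exact compatibility of `realize` -/

section Homomorphism

variable {N : ℕ} [NeZero N] {L : Type*} [LieRing L] [LieAlgebra ℂ L] {e : ZMod N → L}

theorem realize_loopGen (hN : 3 ≤ N) (j : ZMod N) : realize e (loopGen j) = e j := by
  obtain ⟨u, hu1, hu0, hu2⟩ := exists_one_eq hN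
  have h1 : ((1 : ℕ) : ZMod N) ≠ 0 := by push_cast; grind
  have h2 := seg_loopGen hN 1 j
  rw [if_neg h1, seg_one] at h2
  rw [h2, realize_loopX, hat_of_ne h1, seg_one]

theorem seg_mem_lieSpan (f : ZMod N → L) (r : ℕ) (i : ZMod N) :
    seg f i r ∈ LieSubalgebra.lieSpan ℂ L (Set.range f) := by
  induction r using Nat.strong_induction_on generalizing i with
  | _ r ih =>
    have h0 (j) : f j ∈ LieSubalgebra.lieSpan ℂ L (Set.range f) :=
      LieSubalgebra.subset_lieSpan (Set.mem_range_self j)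
    rcases r with _ | _ | n
    · rw [seg_zero]; exact LieSubalgebra.zero_mem _
    · rw [zero_add, seg_one]; exact h0 i
    · rw [seg]
      refine LieSubalgebra.add_mem _ (LieSubalgebra.lie_mem _ (h0 i) (ih _ (by omega) _)) ?_
      split_ifs
      · exact ih _ (by omega) _
      · exact LieSubalgebra.zero_mem _

theorem strand_mem_lieSpan (f : ZMod N → L) (r : ℕ) (i : ZMod N) :
    strand f i r ∈ LieSubalgebra.lieSpan ℂ L (Set.range f) := by
  have h0 (j) : f j ∈ LieSubalgebra.lieSpan ℂ L (Set.range f) :=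
    LieSubalgebra.subset_lieSpan (Set.mem_range_self j)
  rcases r with _ | n
  · rw [strand]; exact LieSubalgebra.zero_mem _
  induction n generalizing i with
  | zero => rw [zero_add, strand]; exact h0 i
  | succ n ih => rw [strand]; exact LieSubalgebra.lie_mem _ (h0 i) (ih _)

theorem integral_mem_lieSpan (f : ZMod N → L) (k : ZMod N → ℂ) (m : ℕ) :
    integral f k m ∈ LieSubalgebra.lieSpan ℂ L (Set.range f) := by
  rw [integral]
  split_ifs
  · exact sum_mem fun i _ => LieSubalgebra.smul_mem _ _
      (LieSubalgebra.subset_lieSpan (Set.mem_range_self i))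
  · exact sum_mem fun i _ => LieSubalgebra.smul_mem _ _ (LieSubalgebra.add_mem _
      (strand_mem_lieSpan _ _ _) (LieSubalgebra.smul_mem _ _ (strand_mem_lieSpan _ _ _)))

theorem lie_eq_zero_of_forall_generator
    (hgen : LieSubalgebra.lieSpan ℂ L (Set.range e) = ⊤) {c : L} (hc : ∀ j, ⁅e j, c⁆ = 0) (y : L) :
    ⁅y, c⁆ = 0 := by
  have hy : y ∈ LieSubalgebra.lieSpan ℂ L (Set.range e) := by rw [hgen]; trivial
  induction hy using LieSubalgebra.lieSpan_induction with
  | mem y hy => obtain ⟨j, rfl⟩ := hy; exact hc j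
  | zero => exact zero_lie _
  | add y z _ _ hy hz => rw [add_lie, hy, hz, add_zero]
  | smul a y _ hy => rw [smul_lie, hy, smul_zero]
  | lie y z _ _ hy hz => rw [lie_lie, hy, hz, lie_zero, lie_zero, sub_zero]

theorem lie_seg_sub_seg_mem {C : Submodule ℂ L} (hN : 3 ≤ N) (he : DolanGrady e)
    (hC : ∀ n : ℕ, (n : ZMod N) = 0 → ∑ b, seg e b n ∈ C) (hC0 : ∀ c ∈ C, ∀ y : L, ⁅y, c⁆ = 0)
    {r q : ℕ} (hr : (r : ZMod N) ≠ 0) (hq : (q : ZMod N) ≠ 0) (hrq : (r : ZMod N) + q ≠ 0)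
    (a b : ZMod N) (hb : b = a + r) : ⁅seg e a r, seg e b q⁆ - seg e a (r + q) ∈ C := by
  have h1 := lie_realize_sub_mem_of_mem hC0 (lie_realize_sub_mem hC hN he) (realize_loopGen hN)
    (seg_mem_lieSpan loopGen r a) (loopX b q)
  rw [seg_loopGen hN, if_neg hr, lie_loopX a b (b + q) r q hb rfl (by grind) (by grind) (by grind),
    realize_loopX, realize_loopX, realize_loopX, hat_of_ne hr, hat_of_ne hq,
    hat_of_ne (by exact_mod_cast hrq)] at h1
  exact h1

section Center

variable (hN : 3 ≤ N) (he : DolanGrady e) (hgen : LieSubalgebra.lieSpan ℂ L (Set.range e) = ⊤)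
include hN he hgen

theorem lie_sum_seg_eq_zero {n : ℕ} (hn : (n : ZMod N) = 0) (y : L) :
    ⁅y, ∑ b, seg e b n⁆ = 0 := by
  rcases n with _ | n
  · simp
  · exact lie_eq_zero_of_forall_generator hgen (lie_sum_seg hN he (by exact_mod_cast hn)) y

/-- Brackets of segments with three distinct ends are known up to central elements, so their
brackets with other elements are known. -/
theorem lie_lie_seg {r q : ℕ} (hr : (r : ZMod N) ≠ 0) (hq : (q : ZMod N) ≠ 0)
    (hrq : (r : ZMod N) + q ≠ 0) (a b : ZMod N) (hb : b = a + r) (y : L) :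
    ⁅y, ⁅seg e a r, seg e b q⁆⁆ = ⁅y, seg e a (r + q)⁆ := by
  have h := lie_seg_sub_seg_mem (C := (LieModule.maxTrivSubmodule ℂ L L).toSubmodule) hN he
    (fun n hn => (LieModule.mem_maxTrivSubmodule ℂ L L _).mpr fun y =>
      lie_sum_seg_eq_zero hN he hgen hn y)
    (fun c hc => (LieModule.mem_maxTrivSubmodule ℂ L L c).mp hc) hr hq hrq a b hb
  rw [← sub_eq_zero, ← lie_sub]
  exact (LieModule.mem_maxTrivSubmodule ℂ L L _).mp h y

/-- Jacobi for three segments that together close up around the cycle; replacing inner brackets by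
segments is harmless, since the error is central. -/
theorem lie_seg_add {s t q : ℕ} (hs : (s : ZMod N) ≠ 0) (ht : (t : ZMod N) ≠ 0)
    (hst : (s : ZMod N) + t ≠ 0) (hq : (s : ZMod N) + t + q = 0) (i : ZMod N) :
    ⁅seg e i (s + t), seg e (i + s + t) q⁆ =
      ⁅seg e i s, seg e (i + s) (t + q)⁆ + ⁅seg e (i + s) t, seg e (i + s + t) (q + s)⁆ := by
  have h1 : ⁅seg e i (s + t), seg e (i + s + t) q⁆ =
      ⁅⁅seg e i s, seg e (i + s) t⁆, seg e (i + s + t) q⁆ := by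
    rw [← lie_skew, ← lie_skew _ (seg e (i + s + t) q), lie_lie_seg hN he hgen hs ht hst _ _ rfl]
  have h2 := lie_lie_seg hN he hgen (r := t) (q := q) ht (by grind) (by grind) (i + s) (i + s + t)
    rfl (seg e i s)
  have h3 := lie_lie_seg hN he hgen (r := q) (q := s) (by grind) hs (by grind) (i + s + t) i
    (by grind) (seg e (i + s) t)
  rw [h1, lie_lie, h2, ← lie_skew (seg e i s) (seg e (i + s + t) q), lie_neg, h3]
  abel

theorem lie_seg_eq_sum (s : ℕ) : ∀ (q : ℕ) (i : ZMod N), (s : ZMod N) ≠ 0 →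
    (s : ZMod N) + q = 0 → ⁅seg e i s, seg e (i + s) q⁆ =
      ∑ k ∈ Finset.range s, seg e (i + k) (s + q) := by
  obtain ⟨u, hu1, hu0, hu2⟩ := exists_one_eq hN
  have hone (q : ℕ) (i : ZMod N) (hq : (1 : ZMod N) + q = 0) :
      ⁅seg e i 1, seg e (i + 1) q⁆ = seg e i (1 + q) := by
    obtain ⟨n, rfl⟩ : ∃ n, q = n + 1 := by
      rcases q with _ | n
      · grind
      · exact ⟨n, rfl⟩
    push_cast at hq
    rw [seg_one, show 1 + (n + 1) = n + 2 by ring, seg_of_ne (by grind)]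
  induction s using Nat.strong_induction_on with
  | _ s ih =>
    intro q i hs hq
    have key (s' t : ℕ) (hs1 : s' < s) (ht1 : t < s) (hst : s' + t = s) (hs' : (s' : ZMod N) ≠ 0)
        (ht : (t : ZMod N) ≠ 0) : ⁅seg e i s, seg e (i + s) q⁆ =
          ∑ k ∈ Finset.range s, seg e (i + k) (s + q) := by
      subst hst
      push_cast at hs hq ⊢
      rw [← add_assoc, lie_seg_add hN he hgen hs' ht hs hq,
        ih s' hs1 (t + q) i hs' (by push_cast; grind),
        ih t ht1 (q + s') (i + s') ht (by push_cast; grind), Finset.sum_range_add]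
      congr 1
      · simp only [add_assoc]
      · refine Finset.sum_congr rfl fun k _ => ?_
        push_cast
        rw [add_assoc i, show t + (q + s') = s' + t + q by ring]
    rcases s with _ | _ | s
    · simp at hs
    · simpa using hone q i (by simpa using hq)
    · push_cast at hs
      -- One letter is split off, unless this leaves a length divisible by `N`; then two are split
      -- off.
      by_cases h : (s : ZMod N) + 1 = 0
      · rcases s with _ | s
        · grind
        push_cast at h
        exact key (s + 1) 2 (by omega) (by omega) (by omega) (by push_cast; grind)
          (by push_cast; grind)
      · exact key (s + 1) 1 (by omega) (by omega) (by omega) (by push_cast; grind)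
          (by push_cast; grind)

/-- By `lie_seg_eq_sum`, bracketing a segment of length n - 1 with the letter closing it up gives n
- 1 shifted segments; in the opposite order it gives the remaining one. Antisymmetry makes all n sum
to zero, and this is n / N times the sum over the cycle. -/
theorem sum_seg_eq_zero {n : ℕ} (hn : (n : ZMod N) = 0) : ∑ b, seg e b n = 0 := by
  obtain ⟨u, hu1, hu0, hu2⟩ := exists_one_eq hN
  rcases n with _ | _ | n
  · simp
  · push_cast at hn; grind
  push_cast at hn
  have h1 (i : ZMod N) : ∑ k ∈ Finset.range (n + 2), seg e (i + k) (n + 2) = 0 := by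
    have h2 := lie_seg_eq_sum hN he hgen (n + 1) 1 (i + 1) (by push_cast; grind)
      (by push_cast; grind)
    have h3 : i + 1 + ((n + 1 : ℕ) : ZMod N) = i := by push_cast; grind
    rw [h3, seg_one, ← lie_skew, ← seg_of_ne (by grind)] at h2
    rw [Finset.sum_range_succ', Nat.cast_zero, add_zero, ← neg_eq_iff_add_eq_zero.mp h2, add_comm]
    congr 1
    refine Finset.sum_congr rfl fun k _ => ?_
    push_cast
    ring_nf
  obtain ⟨m, hm⟩ := (ZMod.natCast_eq_zero_iff (n + 2) N).mp (by push_cast; grind)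
  have h4 (m : ℕ) (f : ZMod N → L) : ∑ k ∈ Finset.range (N * m), f k = m • ∑ b, f b := by
    induction m with
    | zero => simp
    | succ m ih =>
      rw [Nat.mul_succ, Finset.sum_range_add, ih, succ_nsmul, ← sum_range_natCast_add f 0]
      simp
  have h5 := h1 0
  simp only [zero_add] at h5
  rw [hm, h4 m fun b => seg e b (N * m)] at h5
  have h6 : (m : ℂ) ≠ 0 := by
    rintro h
    rw [Nat.cast_eq_zero] at h
    subst h
    omega
  rw [← Nat.cast_smul_eq_nsmul ℂ] at h5
  rw [hm]
  exact (smul_eq_zero.mp h5).resolve_left h6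

theorem lie_realize {y : LoopMatrix N}
    (hy : y ∈ LieSubalgebra.lieSpan ℂ (LoopMatrix N) (Set.range loopGen)) (x : LoopMatrix N) :
    ⁅realize e y, realize e x⁆ = realize e ⁅y, x⁆ := by
  have h := lie_realize_sub_mem_of_mem (C := ⊥) (by rintro c rfl y; exact lie_zero y)
    (lie_realize_sub_mem (fun n hn => (sum_seg_eq_zero hN he hgen hn : _ = (0 : L))) hN he)
    (realize_loopGen hN) hy x
  exact sub_eq_zero.mp h

theorem realize_strand (r : ℕ) (i : ZMod N) :
    realize e (strand loopGen i r) = strand e i r := by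
  rcases r with _ | n
  · rw [strand, strand, map_zero]
  induction n generalizing i with
  | zero => rw [zero_add, strand, strand, realize_loopGen hN]
  | succ n ih =>
    rw [strand, strand, ← ih, ← lie_realize hN he hgen
      (LieSubalgebra.subset_lieSpan (Set.mem_range_self i)), realize_loopGen hN]

theorem realize_integral (k : ZMod N → ℂ) (m : ℕ) :
    realize e (integral loopGen k m) = integral e k m := by
  rw [integral, integral, hamiltonian, hamiltonian]
  split_ifs <;>
  simp only [map_sum, map_smul, map_add, realize_loopGen hN, realize_strand hN he hgen]

theorem lie_integral_of_loopGen (k : ZMod N → ℂ) (m n : ℕ)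
    (h : ⁅integral (loopGen (N := N)) k m, integral loopGen k n⁆ = 0) :
    ⁅integral e k m, integral e k n⁆ = 0 := by
  rw [← realize_integral hN he hgen, ← realize_integral hN he hgen,
    lie_realize hN he hgen (integral_mem_lieSpan _ _ _), h, map_zero]

end Center

end Homomorphism

/-! ### Strings and integrals in the model -/

section LoopIntegrals

variable {N : ℕ}

theorem T_smul_matUnit (a b : ZMod N) (q r : ℤ) :
    (T q : ℂ[T;T⁻¹]) • matUnit a b r = matUnit a b (q + r) := by
  rw [matUnit, matUnit, Matrix.smul_single, smul_eq_mul, LaurentPolynomial.T_add]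

theorem natCast_ne_zero_of_lt {s : ℕ} (h0 : 0 < s) (h1 : s < N) : (s : ZMod N) ≠ 0 := by
  rw [Ne, ZMod.natCast_eq_zero_iff]
  exact fun h => absurd (Nat.le_of_dvd h0 h) (by omega)

variable (N) in
/-- The scalar `t + (-1) ^ N t⁻¹`, where `t = T ^ N`. -/
noncomputable def loopU : ℂ[T;T⁻¹] := T N + (-1) ^ N * T (-N)

variable (N) in
/-- The scalar `t - (-1) ^ N t⁻¹`, where `t = T ^ N`. -/
noncomputable def loopV : ℂ[T;T⁻¹] := T N - (-1) ^ N * T (-N)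

variable (N) in
/-- The coefficient of the upper matrix unit in the strings of length between `N m + 1` and
`N m + N - 1`. -/
noncomputable def upper : ℕ → ℂ[T;T⁻¹]
  | 0 => 1
  | m + 1 => loopU N ^ m * loopV N

variable (N) in
/-- The coefficient of the lower matrix unit, up to sign. -/
noncomputable def lower : ℕ → ℂ[T;T⁻¹]
  | 0 => 1
  | m + 1 => -(loopU N ^ m * loopV N)

theorem upper_succ (m : ℕ) :
    upper N (m + 1) = upper N m * T N - (-1) ^ N * lower N m * T (-N) := by
  rcases m with _ | m
  · simp [upper, lower, loopV]
  · rw [upper, upper, lower, pow_succ, loopU]; ring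

variable [NeZero N]

theorem dolanGrady_loopGen (hN : 3 ≤ N) : DolanGrady (loopGen (N := N)) := by
  obtain ⟨u, hu1, hu0, hu2⟩ := exists_one_eq hN
  have h1 (j : ZMod N) : loopGen j = loopX j (0 + 1) := by simp [loopX, loopGen]
  have h0 (j : ZMod N) : loopX j 0 = 0 := by simp [loopX]
  constructor
  · rintro i j (rfl | rfl)
    · rw [h1 (i + 1), lie_loopGen_loopX, if_pos rfl, if_neg (by grind), if_neg (by push_cast; grind),
        if_neg (by push_cast; grind), add_zero, sub_zero, sub_zero, lie_loopGen_loopX 1,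
        if_neg (by grind), if_pos rfl, if_neg (by push_cast; grind), if_neg (by push_cast; grind)]
      simp
    · rw [h1 j, lie_loopGen_loopX, if_neg (by grind), if_neg (by grind), if_pos (by push_cast; grind),
        if_neg (by push_cast; grind), add_zero, zero_sub, sub_zero, lie_neg, lie_loopGen_loopX 1,
        if_neg (by grind), if_neg (by grind), if_neg (by push_cast; grind), if_pos (by push_cast; rfl)]
      simp
  · intro i j h
    rw [Adjacent, not_or] at h
    obtain ⟨h2, h3⟩ := h
    rw [h1 j, lie_loopGen_loopX, h0, h0, if_neg (Ne.symm h2),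
      if_neg (by push_cast; grind : ¬ j + ((0 : ℕ) : ZMod N) + 1 = i)]
    simp

/-- As long as the length has not gone round the cycle, a new letter meets each matrix unit at one
end only. -/
theorem strand_loopGen_add {n : ℕ} {x y : ℂ[T;T⁻¹]} (h : ∀ i, strand loopGen i (n + 1) =
      x • matUnit i (i + 1 : ZMod N) 1 + y • matUnit (i + 1) i (-1)) (s : ℕ) (hs : s + 2 ≤ N) :
    ∀ i : ZMod N, strand loopGen i (n + s + 1) = x • matUnit i (i + (s : ZMod N) + 1) (s + 1) +
      ((-1) ^ s * y) • matUnit (i + (s : ZMod N) + 1) i (-(s + 1)) := by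
  induction s with
  | zero => intro i; simpa using h i
  | succ s ih =>
    intro i
    have h1 : (s : ZMod N) + 1 ≠ 0 := by
      exact_mod_cast natCast_ne_zero_of_lt (N := N) (s := s + 1) (by omega) (by omega)
    have h2 : (s : ZMod N) + 2 ≠ 0 := by
      exact_mod_cast natCast_ne_zero_of_lt (N := N) (s := s + 2) (by omega) (by omega)
    obtain ⟨u, hu1, hu0, hu2⟩ := exists_one_eq (N := N) (by omega)
    have h3 : i + 1 + (s : ZMod N) + 1 = i + ((s + 1 : ℕ) : ZMod N) + 1 := by push_cast; ring
    obtain ⟨b, hb⟩ : ∃ b, b = i + ((s + 1 : ℕ) : ZMod N) + 1 := ⟨_, rfl⟩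
    rw [← add_assoc n, strand, ih (by omega), h3, ← hb, lie_add, lie_smul, lie_smul, lie_matUnit,
      lie_matUnit]
    push_cast at hb
    rw [if_pos rfl, if_neg (by grind), if_neg (by grind), if_neg (by grind), if_neg (by grind),
      if_neg (by grind), if_neg (by grind), if_pos rfl, pow_succ]
    push_cast
    rw [show -((s : ℤ) + 1) - 1 = -(s + 1 + 1) by ring]
    module

/-- At length `n + N` the string is a scalar times a diagonal matrix; the next letter restores the
shape of length `n + 1`, with new coefficients. -/
theorem strand_loopGen_wrap {n : ℕ} {x y : ℂ[T;T⁻¹]} (hN : 3 ≤ N)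
    (h : ∀ i, strand loopGen i (n + 1) =
      x • matUnit i (i + 1 : ZMod N) 1 + y • matUnit (i + 1) i (-1)) (i : ZMod N) :
    strand loopGen i (n + N + 1) =
      (x * T N - (-1) ^ N * y * T (-N)) • (matUnit i (i + 1) 1 - matUnit (i + 1) i (-1)) := by
  obtain ⟨u, hu1, hu0, hu2⟩ := exists_one_eq hN
  obtain ⟨s, rfl⟩ : ∃ s, N = s + 2 := ⟨N - 2, by omega⟩
  have hs : (s : ZMod (s + 2)) + 2 = 0 := by exact_mod_cast ZMod.natCast_self (s + 2)
  have h1 (i : ZMod (s + 2)) : strand loopGen i (n + (s + 2)) =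
      (x * T (s + 2) - (-1) ^ s * y * T (-(s + 2))) •
        (matUnit i i 0 - matUnit (i + 1) (i + 1) 0) := by
    rw [← add_assoc, strand, strand_loopGen_add h s le_rfl, lie_add, lie_smul, lie_smul,
      lie_matUnit, lie_matUnit, if_pos rfl, if_neg (by grind), if_pos (by grind), if_neg (by grind),
      if_neg (by grind), if_pos (by grind), if_neg (by grind), if_pos rfl, sub_smul, mul_smul x,
      mul_smul (_ * y), smul_sub (T _), smul_sub (T _)]
    simp only [T_smul_matUnit]
    rw [show i + 1 + (s : ZMod (s + 2)) + 1 = i by grind,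
      show (s : ℤ) + 1 + 1 = s + 2 + 0 by ring, show -((s : ℤ) + 1) - 1 = -(s + 2) + 0 by ring]
    module
  rw [show n + (s + 2) + 1 = n + s + 1 + 2 by ring, strand,
    show n + s + 1 + 1 = n + (s + 2) by ring, h1, lie_smul, lie_sub, lie_matUnit, lie_matUnit,
    if_pos rfl, if_neg (by grind), if_neg (by grind), if_pos rfl, if_neg (by grind),
    if_neg (by grind), if_neg (by grind), if_neg (by grind)]
  push_cast
  rw [pow_add]
  norm_num

theorem strand_loopGen (hN : 3 ≤ N) (m : ℕ) (i : ZMod N) : strand loopGen i (N * m + 1) =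
    upper N m • matUnit i (i + 1) 1 + lower N m • matUnit (i + 1) i (-1) := by
  induction m generalizing i with
  | zero => simp [strand, upper, lower, loopGen]
  | succ m ih =>
    rw [Nat.mul_succ, strand_loopGen_wrap hN ih, ← upper_succ, smul_sub, sub_eq_add_neg, ← neg_smul]
    rfl

/-- The long string is antisymmetric in the two matrix units of `loopGen i`. Twice the short string,
whose ends are the same two vertices, equalizes the two coefficients; this explains the 2 in the
definition of the integrals. -/
theorem integral_loopGen_succ (hN : 3 ≤ N) (k : ZMod N → ℂ) (m : ℕ) :
    integral loopGen k (m + 1) =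
      (upper N m * T N + (-1) ^ N * lower N m * T (-N)) • hamiltonian loopGen k := by
  obtain ⟨s, hs⟩ : ∃ s, N = s + 2 := ⟨N - 2, by omega⟩
  have hs1 : (s : ZMod N) + 2 = 0 := by
    exact_mod_cast (ZMod.natCast_eq_zero_iff (s + 2) N).mpr ⟨1, by omega⟩
  rw [integral, if_neg (by omega), hamiltonian, Finset.smul_sum]
  refine Finset.sum_congr rfl fun i _ => ?_
  rw [smul_comm _ (k i)]
  congr 1
  have h2 : N * (m + 1) - 1 = N * m + s + 1 := by rw [Nat.mul_succ]; omega
  rw [two_smul, h2, strand_loopGen_add (strand_loopGen hN m) s (by omega), strand_loopGen hN,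
    show i + 1 + (s : ZMod N) + 1 = i by grind, loopGen, upper_succ]
  have h3 : lower N (m + 1) = -upper N (m + 1) := rfl
  have h4 : (s : ℤ) + 1 = N + (-1) := by omega
  have h5 : -((N : ℤ) + (-1)) = -N + 1 := by ring
  have h6 : ((-1) ^ s : ℂ[T;T⁻¹]) = (-1) ^ N := by rw [hs, pow_add]; norm_num
  rw [h3, upper_succ, h4, h5, h6, ← T_smul_matUnit, ← T_smul_matUnit]
  module

/-- The polynomial that expresses the integrals through `loopU`. -/
noncomputable def charge (N : ℕ) : ℕ → ℂ[X]
  | 0 => 1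
  | 1 => Polynomial.X
  | m + 2 => Polynomial.X ^ m * (Polynomial.X ^ 2 - Polynomial.C (4 * (-1) ^ N))

theorem integral_loopGen (hN : 3 ≤ N) (k : ZMod N → ℂ) (m : ℕ) :
    integral loopGen k m = Polynomial.aeval (loopU N) (charge N m) • hamiltonian loopGen k := by
  rcases m with _ | _ | m
  · simp [integral, charge]
  · rw [integral_loopGen_succ hN, charge, upper, lower, Polynomial.aeval_X, loopU]
    simp
  · rw [integral_loopGen_succ hN, charge, upper, lower]
    congr 1
    have h1 : (T N : ℂ[T;T⁻¹]) * T (-N) = 1 := by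
      rw [← LaurentPolynomial.T_add, add_neg_cancel, LaurentPolynomial.T_zero]
    have h2 : ((-1) ^ N * (-1) ^ N : ℂ[T;T⁻¹]) = 1 := by rw [← mul_pow]; simp
    simp only [map_mul, map_sub, map_pow, Polynomial.aeval_X, map_neg, map_one,
      map_ofNat]
    rw [loopU, loopV]
    linear_combination (-4 * (-1) ^ N * (T N + (-1) ^ N * T (-N)) ^ m) * h1

theorem lie_integral_loopGen (hN : 3 ≤ N) (k : ZMod N → ℂ) (m n : ℕ) :
    ⁅integral (loopGen (N := N)) k m, integral loopGen k n⁆ = 0 := by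
  rw [integral_loopGen hN, integral_loopGen hN, lie_smul, smul_lie, lie_self, smul_zero, smul_zero]

end LoopIntegrals

/-! ### Linear independence in the model -/

section LinearIndependence

/-- The polynomials `charge N m` as a sequence of polynomials of degree `m`. -/
noncomputable def chargeSequence (N : ℕ) : Polynomial.Sequence ℂ where
  elems' := charge N
  degree_eq' m := by
    rcases m with _ | _ | m
    · simp [charge]
    · simp [charge]
    · rw [charge, Polynomial.degree_mul, Polynomial.degree_X_pow,
        Polynomial.degree_X_pow_sub_C two_pos]
      rfl

variable {N : ℕ} [NeZero N]

theorem hamiltonian_loopGen_apply (hN : 3 ≤ N) (k : ZMod N → ℂ) (i : ZMod N) :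
    hamiltonian loopGen k i (i + 1) = k i • T 1 := by
  obtain ⟨u, hu1, hu0, hu2⟩ := exists_one_eq hN
  rw [hamiltonian, Matrix.sum_apply, Finset.sum_eq_single i]
  · rw [Matrix.smul_apply, loopGen, Matrix.add_apply, matUnit, matUnit, Matrix.single_apply_same,
      Matrix.single_apply_of_ne _ _ _ _ _ (by grind), add_zero]
  · intro j _ hj
    rw [Matrix.smul_apply, loopGen, Matrix.add_apply, matUnit, matUnit,
      Matrix.single_apply_of_ne _ _ _ _ _ (by grind),
      Matrix.single_apply_of_ne _ _ _ _ _ (by grind), add_zero, smul_zero]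
  · simp

theorem exists_unit_pow_add (N : ℕ) [NeZero N] (w : ℂ) :
    ∃ z : ℂˣ, ((z ^ (N : ℤ) : ℂˣ) : ℂ) + (-1) ^ N * ((z ^ (-N : ℤ) : ℂˣ) : ℂ) = w := by
  -- Here `s` is a square root of the discriminant of y² - wy + (-1)^N, and `z` is an `N`-th root of
  -- a solution y.
  obtain ⟨s, hs⟩ := IsAlgClosed.exists_pow_nat_eq (w ^ 2 - 4 * (-1) ^ N) two_pos
  obtain ⟨z, hz⟩ := IsAlgClosed.exists_pow_nat_eq ((w + s) / 2) (NeZero.pos N)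
  have h1 : (z ^ N) ^ 2 + (-1) ^ N = w * z ^ N := by
    rw [hz]; linear_combination hs / 4
  have h2 : z ^ N ≠ 0 := by
    intro h
    rw [h] at h1
    simp at h1
  have h3 : z ≠ 0 := by
    rintro rfl
    exact h2 (zero_pow (NeZero.ne N))
  refine ⟨Units.mk0 z h3, ?_⟩
  rw [zpow_neg, zpow_natCast, Units.val_inv_eq_inv_val, Units.val_pow_eq_pow_val, Units.val_mk0]
  field_simp
  linear_combination h1

/-- At a nonzero entry of the Hamiltonian, evaluate T at a unit where `loopU` takes the value `w`:
this gives q(w) = 0 for every `w`. -/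
theorem eq_zero_of_aeval_loopU_smul (hN : 3 ≤ N) {k : ZMod N → ℂ} (hk : k ≠ 0) {q : ℂ[X]}
    (hq : Polynomial.aeval (loopU N) q • hamiltonian (loopGen (N := N)) k = 0) : q = 0 := by
  obtain ⟨i, hi⟩ := Function.ne_iff.mp hk
  have h1 := congrFun (congrFun hq i) (i + 1)
  rw [Matrix.smul_apply, hamiltonian_loopGen_apply hN, Matrix.zero_apply, smul_eq_mul,
    LaurentPolynomial.smul_eq_C_mul] at h1
  refine Polynomial.funext fun w => ?_
  obtain ⟨z, hz⟩ := exists_unit_pow_add N w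
  have h2 := congrArg (LaurentPolynomial.eval₂ (RingHom.id ℂ) z) h1
  rw [map_mul, LaurentPolynomial.eval₂_C_mul_T, map_zero, Polynomial.aeval_def,
    Polynomial.hom_eval₂] at h2
  have h3 : (LaurentPolynomial.eval₂ (RingHom.id ℂ) z).comp (algebraMap ℂ ℂ[T;T⁻¹]) =
      RingHom.id ℂ := by
    ext x
    rw [RingHom.comp_apply, LaurentPolynomial.algebraMap_apply, LaurentPolynomial.eval₂_C]
    rfl
  have h4 : LaurentPolynomial.eval₂ (RingHom.id ℂ) z (loopU N) = w := by
    rw [loopU, map_add, map_mul, map_pow, map_neg, map_one, LaurentPolynomial.eval₂_T,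
      LaurentPolynomial.eval₂_T, hz]
  rw [h3, h4] at h2
  rw [Polynomial.eval_zero]
  exact (mul_eq_zero.mp h2).resolve_right (mul_ne_zero hi (Units.ne_zero _))

theorem linearIndependent_integral_loopGen (hN : 3 ≤ N) {k : ZMod N → ℂ} (hk : k ≠ 0) :
    LinearIndependent ℂ fun m : ℕ => integral (loopGen (N := N)) k m := by
  let g : ℂ[X] →ₗ[ℂ] LoopMatrix N :=
    (LinearMap.toSpanSingleton ℂ[T;T⁻¹] (LoopMatrix N) (hamiltonian loopGen k)).restrictScalars ℂ ∘ₗ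
      (Polynomial.aeval (loopU N)).toLinearMap
  have h1 := (chargeSequence N).linearIndependent.map' g
    (LinearMap.ker_eq_bot'.mpr fun q hq => eq_zero_of_aeval_loopU_smul hN hk hq)
  rw [show (fun m : ℕ => integral (loopGen (N := N)) k m) = g ∘ chargeSequence N from
    funext fun m => integral_loopGen hN k m]
  exact h1

end LinearIndependence

/-! ### The presentation of A_N and its universal property -/

section Presentation

variable {N : ℕ}

/-- The quotient map from the free Lie algebra. -/
noncomputable def quotientHom (N : ℕ) : FreeLieAlgebra ℂ (ZMod N) →ₗ⁅ℂ⁆ OnsagerAlgebra N :=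
  { (LieSubmodule.Quotient.mk' (relationIdeal N) :
      FreeLieAlgebra ℂ (ZMod N) →ₗ[ℂ] OnsagerAlgebra N) with
    map_lie' := fun {x y} => LieSubmodule.Quotient.mk_bracket (relationIdeal N) x y }

theorem quotientHom_eq_zero {x : FreeLieAlgebra ℂ (ZMod N)} (hx : x ∈ relators N) :
    quotientHom N x = 0 :=
  LieSubmodule.Quotient.mk_eq_zero'.mpr (LieSubmodule.subset_lieSpan hx)

theorem dolanGrady_gen : DolanGrady (gen (N := N)) where
  adjacent i j h := by
    have h1 := quotientHom_eq_zero (N := N) (Or.inl ⟨i, j, h, rfl⟩)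
    rw [map_sub, LieHom.map_lie, LieHom.map_lie] at h1
    exact sub_eq_zero.mp h1
  not_adjacent i j h := by
    have h1 := quotientHom_eq_zero (N := N) (Or.inr ⟨i, j, h, rfl⟩)
    rwa [LieHom.map_lie] at h1

theorem lieSpan_range_gen :
    LieSubalgebra.lieSpan ℂ (OnsagerAlgebra N) (Set.range gen) = ⊤ := by
  set K := LieSubalgebra.lieSpan ℂ (OnsagerAlgebra N) (Set.range gen)
  let g : FreeLieAlgebra ℂ (ZMod N) →ₗ⁅ℂ⁆ K := FreeLieAlgebra.lift ℂ fun i =>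
    ⟨gen i, LieSubalgebra.subset_lieSpan (Set.mem_range_self i)⟩
  have h1 : K.incl.comp g = quotientHom N := by
    refine FreeLieAlgebra.hom_ext fun i => ?_
    rw [LieHom.comp_apply, FreeLieAlgebra.lift_of_apply]
    rfl
  rw [eq_top_iff]
  rintro x -
  obtain ⟨y, rfl⟩ := LieSubmodule.Quotient.surjective_mk' (relationIdeal N) x
  change quotientHom N y ∈ K
  rw [← h1]
  exact (g y).2

variable {L : Type*} [LieRing L] [LieAlgebra ℂ L] {e : ZMod N → L}

theorem exists_hom_of_dolanGrady (he : DolanGrady e) :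
    ∃ f : OnsagerAlgebra N →ₗ⁅ℂ⁆ L, ∀ i, f (gen i) = e i := by
  let F : FreeLieAlgebra ℂ (ZMod N) →ₗ⁅ℂ⁆ L := FreeLieAlgebra.lift ℂ e
  have hF (i : ZMod N) : F (letter i) = e i := FreeLieAlgebra.lift_of_apply ..
  have h1 : relationIdeal N ≤ F.ker := by
    refine LieSubmodule.lieSpan_le.mpr ?_
    rintro x (⟨i, j, h, rfl⟩ | ⟨i, j, h, rfl⟩)
    · simp [LieHom.mem_ker, hF, he.adjacent i j h]
    · simp [LieHom.mem_ker, hF, he.not_adjacent i j h]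
  let f : OnsagerAlgebra N →ₗ[ℂ] L := (relationIdeal N).toSubmodule.liftQ
    (F : FreeLieAlgebra ℂ (ZMod N) →ₗ[ℂ] L) fun _ hx => h1 hx
  refine ⟨{ f with map_lie' := fun {x y} => ?_ }, hF⟩
  obtain ⟨x, rfl⟩ := LieSubmodule.Quotient.surjective_mk' (relationIdeal N) x
  obtain ⟨y, rfl⟩ := LieSubmodule.Quotient.surjective_mk' (relationIdeal N) y
  exact F.map_lie x y

variable {L' : Type*} [LieRing L'] [LieAlgebra ℂ L'] {e' : ZMod N → L'}

theorem map_strand (f : L →ₗ⁅ℂ⁆ L') (hf : ∀ i, f (e i) = e' i) (r : ℕ) (i : ZMod N) :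
    f (strand e i r) = strand e' i r := by
  rcases r with _ | n
  · rw [strand, strand, map_zero]
  induction n generalizing i with
  | zero => rw [zero_add, strand, strand, hf]
  | succ n ih => rw [strand, strand, LieHom.map_lie, hf, ih]

theorem map_integral [NeZero N] (f : L →ₗ⁅ℂ⁆ L') (hf : ∀ i, f (e i) = e' i) (k : ZMod N → ℂ)
    (m : ℕ) : f (integral e k m) = integral e' k m := by
  rw [integral, integral, hamiltonian, hamiltonian]
  split_ifs <;> simp only [map_sum, map_smul, map_add, hf, map_strand f hf]

end Presentation

end SlOnsager

theorem mainTheorem6 (N : ℕ) [NeZero N] (hN : 3 ≤ N) (k : ZMod N → ℂ) :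
    (∀ m n : ℕ, ⁅SlOnsager.integral (L := SlOnsager.OnsagerAlgebra N) SlOnsager.gen k m,
        SlOnsager.integral (L := SlOnsager.OnsagerAlgebra N) SlOnsager.gen k n⁆ = 0) ∧
    (∀ (V : Type*) [AddCommGroup V] [Module ℂ V] (e : ZMod N → Module.End ℂ V),
        SlOnsager.DolanGrady e →
        ∀ m n : ℕ, Commute (SlOnsager.integral e k m) (SlOnsager.integral e k n)) ∧
    (k ≠ 0 → LinearIndependent ℂ
      (fun m : ℕ => SlOnsager.integral (L := SlOnsager.OnsagerAlgebra N) SlOnsager.gen k m)) := by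
  have h1 (m n : ℕ) : ⁅SlOnsager.integral (L := SlOnsager.OnsagerAlgebra N) SlOnsager.gen k m,
      SlOnsager.integral (L := SlOnsager.OnsagerAlgebra N) SlOnsager.gen k n⁆ = 0 :=
    SlOnsager.lie_integral_of_loopGen hN SlOnsager.dolanGrady_gen SlOnsager.lieSpan_range_gen k m n
      (SlOnsager.lie_integral_loopGen hN k m n)
  refine ⟨h1, fun V _ _ e he m n => ?_, fun hk => ?_⟩
  -- The operators need not generate `Module.End ℂ V`, so the identity is transported from A_N.
  · obtain ⟨f, hf⟩ := SlOnsager.exists_hom_of_dolanGrady he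
    rw [commute_iff_lie_eq, ← SlOnsager.map_integral f hf, ← SlOnsager.map_integral f hf,
      ← LieHom.map_lie, h1, map_zero]
  · obtain ⟨f, hf⟩ := SlOnsager.exists_hom_of_dolanGrady (SlOnsager.dolanGrady_loopGen hN)
    refine LinearIndependent.of_comp (f : SlOnsager.OnsagerAlgebra N →ₗ[ℂ] SlOnsager.LoopMatrix N) ?_
    have h2 := SlOnsager.linearIndependent_integral_loopGen hN hk
    rw [← funext fun m => SlOnsager.map_integral f hf k m] at h2
    exact h2
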